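/- **Theorem (Construction of a restricted EPPA-witness).** Let $L$ be a language consisting of relation symbols (of arities $\ge 1$) and unary function symbols, equipped with a permutation group $\Gamma_L$, i.e. a group of permutations of $L$ preserving types and arities of symbols. A $\Gamma_L$-structure $\mathbf A$ has a vertex set $A$, a relation $R_{\mathbf A}\subseteq A^{a(R)}$ for every relation symbol $R$ of arity $a(R)$, and a function $F_{\mathbf A}\colon A\to\mathcal P(A)$ for every function symbol $F$. A *homomorphism* $f\colon\mathbf A\to\mathbf B$ is a pair $(f_L,f_A)$ with $f_L\in\Gamma_L$ and $f_A\colon A\to B$ such that $\bar x\in R_{\mathbf A}$ implies $f_A(\bar x)\in f_L(R)_{\mathbf B}$, and $f_A(F_{\mathbf A}(x))\subseteq f_L(F)_{\mathbf B}(f_A(x))$. It is an *embedding* if $f_A$ is injective, the implication is an equivalence and the inclusion is an equality; it is an *isomorphism* if moreover $f_A$ is onto. A *substructure* of $\mathbf A$ is a (possibly empty) subset of $A$ closed under all $F_{\mathbf A}$ with the induced structure. Homomorphisms are composed in both components. Given embeddings $\alpha_i\colon\mathbf D\to\mathbf B_i$ ($i=1,2$), a structure $\mathbf C$ with embeddings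 $\beta_i\colon\mathbf B_i\to\mathbf C$ is the *free amalgamation* of $\mathbf B_1,\mathbf B_2$ over $\mathbf D$ with respect to $\alpha_1,\alpha_2$ if $\beta_1\circ\alpha_1=\beta_2\circ\alpha_2$, $\beta_1(B_1)\cap\beta_2(B_2)=\beta_1(\alpha_1(D))$, $C=\beta_1(B_1)\cup\beta_2(B_2)$, and no tuple in a relation of $\mathbf C$ contains vertices of both $\beta_1(B_1\setminus\alpha_1(D))$ and $\beta_2(B_2\setminus\alpha_2(D))$. A structure is *irreducible* if it is not the free amalgamation of two proper substructures over their intersection (with inclusions as embeddings). A *homomorphism-embedding* is a homomorphism whose restriction to every irreducible substructure of its domain is an embedding. *Tree amalgamations of copies of $\mathbf A$* are defined recursively: every structure isomorphic to $\mathbf A$ is one; and if $\mathbf B_1,\mathbf B_2$ are tree amalgamations of copies of $\mathbf A$, and $\delta_1,\delta_2\colon\mathbf D\to\mathbf A$ and $\alpha_i\colon\mathbf A\to\mathbf B_i$ are embeddings, then the free amalgamation of $\mathbf B_1$ and $\mathbf B_2$ over $\mathbf D$ with respect to $\alpha_1\circ\delta_1$ and $\alpha_2\circ\delta_2$ is one.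 A *partial automorphism* of a structure is an isomorphism between two of its substructures. A finite structure $\mathbf B$ is an *EPPA-witness* for a finite structure $\mathbf A$ if there is an embedding $\psi\colon\mathbf A\to\mathbf B$ such that every partial automorphism $f$ of $\psi(\mathbf A)$ extends to an automorphism $\hat f$ of $\mathbf B$ (with the same language permutation). It is *coherent* if $\psi$ and the assignment $f\mapsto\hat f$ can be chosen so that $\hat h=\hat g\circ\hat f$ whenever $h=g\circ f$, $\mathrm{Dom}(f)=\mathrm{Dom}(h)$, $\mathrm{Range}(f)=\mathrm{Dom}(g)$ and $\mathrm{Range}(g)=\mathrm{Range}(h)$. It is *irreducible structure faithful* (with respect to $\psi(\mathbf A)$) if for every irreducible substructure $\mathbf C$ of $\mathbf B$ there is an automorphism $\theta$ of $\mathbf B$ with $\theta(C)\subseteq\psi(A)$. Let $\mathbf A$ be a finite irreducible $\Gamma_L$-structure, let $\mathbf B_0$ be a finite EPPA-witness for $\mathbf A$, and let $n\ge 1$ be an integer. Then there are a finite $\Gamma_L$-structure $\mathbf B$ and an embedding $\psi\colon\mathbf A\to\mathbf B$ such that: 1. $\mathbf B$ is an EPPA-witness for $\mathbf A$ (by means of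 $\psi$), irreducible structure faithful with respect to $\psi(\mathbf A)$. 2. There is a homomorphism-embedding $\mathbf B\to\mathbf B_0$. 3. For every substructure $\mathbf C$ of $\mathbf B$ on at most $n$ vertices there are a tree amalgamation $\mathbf D$ of copies of $\mathbf A$ and a homomorphism-embedding $\mathbf C\to\mathbf D$. 4. If $\mathbf B_0$ is a coherent EPPA-witness for $\mathbf A$, then so is $\mathbf B$ (by means of the same $\psi$). -/

import Mathlib

universe u v w w₁ w₂ w₃

/-- A language consisting of relation symbols and unary function symbols, equipped with a
permutation group `Γ`. All relations have arity at least one: `Rel k` is the set of relation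
symbols of arity `k + 1`. `Fn` is the set of (unary) function symbols. The elements of `Γ` are the
permutations of the symbols that preserve types and arities, i.e. they are given by a permutation
of every `Rel k` and a permutation of `Fn`. -/
structure PermLang where
  Rel : ℕ → Type u
  Fn : Type v
  Γ : Subgroup ((∀ k, Equiv.Perm (Rel k)) × Equiv.Perm Fn)

namespace PermLang

variable {L : PermLang.{u, v}}

/-- The image of a relation symbol under an element of the permutation group. -/
def onRel (g : L.Γ) {k : ℕ} (R : L.Rel k) : L.Rel k := g.1.1 k R

/-- The image of a function symbol under an element of the permutation group. -/
def onFn (g : L.Γ) (F : L.Fn) : L.Fn := g.1.2 F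

end PermLang

/-- A structure with vertex set `V`; the functions are unary and take subsets of `V` as values. -/
structure GStr (L : PermLang.{u, v}) (V : Type w) where
  rel : ∀ {k : ℕ}, L.Rel k → Set (Fin (k + 1) → V)
  fn : L.Fn → V → Set V

namespace GStr

variable {L : PermLang.{u, v}}
variable {V : Type w} {W : Type w₁} {X : Type w₂} {Y : Type w₃}

/-- A homomorphism is a pair of a permutation from `Γ` and a map of vertices. -/
structure Hom (A : GStr L V) (B : GStr L W) where
  lang : L.Γ
  toFun : V → W
  map_rel : ∀ {k : ℕ} (R : L.Rel k) (x : Fin (k + 1) → V),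
    x ∈ A.rel R → (fun i => toFun (x i)) ∈ B.rel (PermLang.onRel lang R)
  map_fn : ∀ (F : L.Fn) (x : V),
    toFun '' A.fn F x ⊆ B.fn (PermLang.onFn lang F) (toFun x)

instance (A : GStr L V) (B : GStr L W) : CoeFun (Hom A B) (fun _ => V → W) := ⟨Hom.toFun⟩

/-- Composition of homomorphisms, `(g.comp f) x = g (f x)`, also on the language part. -/
def Hom.comp {A : GStr L V} {B : GStr L W} {C : GStr L X} (g : Hom B C) (f : Hom A B) :
    Hom A C where
  lang := g.lang * f.lang
  toFun := fun x => g (f x)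
  map_rel := fun R x hx => g.map_rel _ _ (f.map_rel R x hx)
  map_fn := by
    rintro F x _ ⟨y, hy, rfl⟩
    exact g.map_fn _ _ ⟨f y, f.map_fn F x ⟨y, hy, rfl⟩, rfl⟩

/-- A homomorphism is an embedding if it is injective on vertices, reflects relations and
preserves the functions exactly. -/
structure Hom.IsEmbedding {A : GStr L V} {B : GStr L W} (f : Hom A B) : Prop where
  injective : Function.Injective f.toFun
  rel_iff : ∀ {k : ℕ} (R : L.Rel k) (x : Fin (k + 1) → V),
    x ∈ A.rel R ↔ (fun i => f (x i)) ∈ B.rel (PermLang.onRel f.lang R)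
  fn_eq : ∀ (F : L.Fn) (x : V),
    f.toFun '' A.fn F x = B.fn (PermLang.onFn f.lang F) (f x)

/-- An isomorphism is an embedding that is bijective on vertices. -/
structure Hom.IsIso {A : GStr L V} {B : GStr L W} (f : Hom A B) : Prop
    extends f.IsEmbedding where
  surjective : Function.Surjective f.toFun

/-- Embeddings. -/
structure Emb (A : GStr L V) (B : GStr L W) extends Hom A B where
  isEmbedding : toHom.IsEmbedding

/-- Composition of embeddings. -/
def Emb.comp {A : GStr L V} {B : GStr L W} {C : GStr L X} (g : Emb B C) (f : Emb A B) :
    Emb A C where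
  toHom := g.toHom.comp f.toHom
  isEmbedding :=
    { injective := g.isEmbedding.injective.comp f.isEmbedding.injective
      rel_iff := fun R x => (f.isEmbedding.rel_iff R x).trans (g.isEmbedding.rel_iff _ _)
      fn_eq := fun F x => by
        have h := g.isEmbedding.fn_eq (PermLang.onFn f.lang F) (f.toHom x)
        rw [← f.isEmbedding.fn_eq F x, Set.image_image] at h
        exact h }

/-- A substructure is given by a set of vertices that is closed under all functions. -/
@[ext]
structure Substr (A : GStr L V) where
  carrier : Set V
  closed : ∀ (F : L.Fn) (x : V), x ∈ carrier → A.fn F x ⊆ carrier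

/-- The structure induced by `A` on the vertices of a substructure. -/
def Substr.str {A : GStr L V} (S : Substr A) : GStr L S.carrier where
  rel := fun R => {x | (fun i => (x i : V)) ∈ A.rel R}
  fn := fun F x => {y | (y : V) ∈ A.fn F x}

/-- The intersection of two substructures. -/
def Substr.inter {A : GStr L V} (S T : Substr A) : Substr A where
  carrier := S.carrier ∩ T.carrier
  closed := fun F x hx => Set.subset_inter (S.closed F x hx.1) (T.closed F x hx.2)

/-- The inclusion of a substructure, with the identity as its language part. -/
def Substr.incl {A : GStr L V} (S : Substr A) : Emb S.str A where
  lang := 1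
  toFun := Subtype.val
  map_rel := fun _ _ hx => hx
  map_fn := by
    rintro F x _ ⟨y, hy, rfl⟩
    exact hy
  isEmbedding :=
    { injective := Subtype.val_injective
      rel_iff := fun _ _ => Iff.rfl
      fn_eq := fun F x => by
        ext y
        constructor
        · rintro ⟨z, hz, rfl⟩
          exact hz
        · intro hy
          exact ⟨⟨y, S.closed F x x.2 hy⟩, hy, rfl⟩ }

/-- The inclusion of a substructure in a larger substructure. -/
def Substr.inclusion {A : GStr L V} (S T : Substr A) (h : S.carrier ⊆ T.carrier) :
    Emb S.str T.str where
  lang := 1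
  toFun := Set.inclusion h
  map_rel := fun _ _ hx => hx
  map_fn := by
    rintro F x _ ⟨y, hy, rfl⟩
    exact hy
  isEmbedding :=
    { injective := Set.inclusion_injective h
      rel_iff := fun _ _ => Iff.rfl
      fn_eq := fun F x => by
        ext y
        constructor
        · rintro ⟨z, hz, rfl⟩
          exact hz
        · intro hy
          exact ⟨⟨y, S.closed F x x.2 hy⟩, hy, rfl⟩ }

/-- The image of an embedding, as a substructure of the target. -/
def Emb.range {A : GStr L V} {B : GStr L W} (f : Emb A B) : Substr B where
  carrier := Set.range f.toFun
  closed := by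
    rintro F _ ⟨x, rfl⟩ y hy
    have h := f.isEmbedding.fn_eq (PermLang.onFn f.lang⁻¹ F) x
    have e : PermLang.onFn f.lang (PermLang.onFn f.lang⁻¹ F) = F :=
      Equiv.apply_symm_apply f.lang.1.2 F
    rw [e] at h
    rw [← h] at hy
    obtain ⟨z, _, rfl⟩ := hy
    exact ⟨z, rfl⟩

/-- `C` with the embeddings `β₁`, `β₂` is the free amalgamation of `B₁` and `B₂` over `D` with
respect to `α₁` and `α₂`. (The requirement on functions, that a function vanishes on every tuple
with vertices of both sides, is void as all functions are unary.) -/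
structure IsFreeAmalgam {D : GStr L V} {B₁ : GStr L W} {B₂ : GStr L X} {C : GStr L Y}
    (α₁ : Emb D B₁) (α₂ : Emb D B₂) (β₁ : Emb B₁ C) (β₂ : Emb B₂ C) : Prop where
  comm : β₁.comp α₁ = β₂.comp α₂
  strong : ∀ x₁ x₂, β₁.toHom x₁ = β₂.toHom x₂ →
    x₁ ∈ Set.range α₁.toFun ∧ x₂ ∈ Set.range α₂.toFun
  cover : Set.range β₁.toFun ∪ Set.range β₂.toFun = Set.univ
  free : ∀ {k : ℕ} (R : L.Rel k) (x : Fin (k + 1) → Y),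
    (∃ i, x i ∈ β₁.toFun '' (Set.range α₁.toFun)ᶜ) →
    (∃ j, x j ∈ β₂.toFun '' (Set.range α₂.toFun)ᶜ) → x ∉ C.rel R

/-- A structure is irreducible if it is not the free amalgamation of two proper substructures
(over their intersection, all maps being inclusions). -/
def Irreducible (A : GStr L V) : Prop :=
  ¬ ∃ S T : Substr A, S.carrier ≠ Set.univ ∧ T.carrier ≠ Set.univ ∧
    IsFreeAmalgam ((S.inter T).inclusion S Set.inter_subset_left)
      ((S.inter T).inclusion T Set.inter_subset_right) S.incl T.incl

/-- A homomorphism-embedding: a homomorphism whose restriction to every irreducible substructure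
is an embedding. -/
def Hom.IsHomEmbedding {A : GStr L V} {B : GStr L W} (f : Hom A B) : Prop :=
  ∀ C : Substr A, C.str.Irreducible → (f.comp C.incl.toHom).IsEmbedding

/-- Tree amalgamations of copies of `A`. -/
inductive IsTreeAmalgam {V : Type w} (A : GStr L V) : ∀ {W : Type w}, GStr L W → Prop
  | copy {W : Type w} {D : GStr L W} (f : Hom A D) (hf : f.IsIso) : IsTreeAmalgam A D
  | amalgam {W₁ W₂ X Y : Type w} {B₁ : GStr L W₁} {B₂ : GStr L W₂} {D : GStr L X} {C : GStr L Y}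
      (h₁ : IsTreeAmalgam A B₁) (h₂ : IsTreeAmalgam A B₂)
      (α₁ : Emb A B₁) (α₂ : Emb A B₂) (δ₁ δ₂ : Emb D A) (β₁ : Emb B₁ C) (β₂ : Emb B₂ C)
      (h : IsFreeAmalgam (α₁.comp δ₁) (α₂.comp δ₂) β₁ β₂) : IsTreeAmalgam A C

/-- A partial automorphism: an isomorphism between two (possibly empty) substructures. -/
structure PartialAut (A : GStr L V) where
  dom : Substr A
  ran : Substr A
  map : Hom dom.str ran.str
  isIso : map.IsIso

/-- The triple `(f, g, h)` is coherent: the domains and ranges match and `h = g ∘ f` (on the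
vertices and on the language). -/
structure CoherentTriple {A : GStr L V} (f g h : PartialAut A) : Prop where
  dom_eq : f.dom = h.dom
  mid_eq : f.ran = g.dom
  ran_eq : g.ran = h.ran
  lang_eq : h.map.lang = g.map.lang * f.map.lang
  map_eq : ∀ (x : V) (hf : x ∈ f.dom.carrier) (hg : (f.map ⟨x, hf⟩ : V) ∈ g.dom.carrier)
    (hh : x ∈ h.dom.carrier), (h.map ⟨x, hh⟩ : V) = g.map ⟨f.map ⟨x, hf⟩, hg⟩

/-- The homomorphism `θ` of `B` to itself extends the partial automorphism `f` of a substructure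
`S` of `B` (on the vertices and on the language). -/
def Extends {B : GStr L W} {S : Substr B} (θ : Hom B B) (f : PartialAut S.str) : Prop :=
  θ.lang = f.map.lang ∧ ∀ x : f.dom.carrier, θ (x : S.carrier) = ((f.map x : S.carrier) : W)

/-- The embedding `ψ` witnesses that `B` is an EPPA-witness for `A`: every partial automorphism of
`ψ(A)` extends to an automorphism of `B`. -/
def IsEPPAVia {A : GStr L V} {B : GStr L W} (ψ : Emb A B) : Prop :=
  ∀ f : PartialAut ψ.range.str, ∃ θ : Hom B B, θ.IsIso ∧ Extends θ f

/-- `B` is an EPPA-witness for `A`. -/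
def IsEPPAWitness (A : GStr L V) (B : GStr L W) : Prop :=
  ∃ ψ : Emb A B, IsEPPAVia ψ

/-- The embedding `ψ` witnesses that `B` is a coherent EPPA-witness for `A`: the extensions can be
chosen so that coherent triples are sent to coherent triples. -/
def IsCoherentVia {A : GStr L V} {B : GStr L W} (ψ : Emb A B) : Prop :=
  ∃ φ : PartialAut ψ.range.str → Hom B B,
    (∀ f, (φ f).IsIso ∧ Extends (φ f) f) ∧
    ∀ f g h, CoherentTriple f g h → φ h = (φ g).comp (φ f)

/-- `B` is a coherent EPPA-witness for `A`. -/
def IsCoherentEPPAWitness (A : GStr L V) (B : GStr L W) : Prop :=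
  ∃ ψ : Emb A B, IsCoherentVia ψ

/-- Irreducible structure faithfulness with respect to `ψ(A)`: every irreducible substructure of
`B` is sent into `ψ(A)` by an automorphism of `B`. -/
def IsFaithfulVia {A : GStr L V} {B : GStr L W} (ψ : Emb A B) : Prop :=
  ∀ C : Substr B, C.str.Irreducible →
    ∃ θ : Hom B B, θ.IsIso ∧ θ.toFun '' C.carrier ⊆ Set.range ψ.toFun

end GStr

/-!
The witness `B₀` is viewed as an atlas: `ψ(A)` and its translates by a group of automorphisms
(the blocks) cover the part of the structure that matters. Decorating every vertex with local
values of a system of valuations, and keeping only the decorations that come from one valuation on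
each block, gives a new atlas over the old one. A partial automorphism of `A` lifts to it by
permuting values, and the choice of the permutations is functorial, so coherence is inherited.

Valuations of two kinds are used. For every set `M` of vertices in no block, injective valuations
of `M` in fewer than `|M|` values: a clique projecting onto `M` would give such a valuation, hence
every clique of the cover lies in a block. So irreducible substructures lie in blocks, which gives
faithfulness and makes every map that is an embedding on blocks a homomorphism-embedding. For every
edge of a set `M` that is in no triangle of `M`, potentials in `ZMod 2` that jump along this edge
only: a substructure of the cover on which the projection creates no new adjacency has an image in
which no cycle passes exactly once through such an edge. An image of this kind splits along cliques
and so, by induction, maps to a tree amalgamation. In the other case the projection reduces the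
number of nonadjacent pairs, so sufficiently many covers of the second kind unwind every
substructure with at most `n` vertices.
-/

namespace GStr

open Equiv
open scoped Pointwise

variable {L : PermLang.{u, v}}

section Embeddings

variable {V W X Z : Type*} {A : GStr L V} {B : GStr L W} {C : GStr L X}

theorem onRel_mul (g h : L.Γ) {k : ℕ} (R : L.Rel k) :
    PermLang.onRel (g * h) R = PermLang.onRel g (PermLang.onRel h R) := rfl

theorem onFn_mul (g h : L.Γ) (F : L.Fn) :
    PermLang.onFn (g * h) F = PermLang.onFn g (PermLang.onFn h F) := rfl

@[simp] theorem onRel_one {k : ℕ} (R : L.Rel k) : PermLang.onRel (1 : L.Γ) R = R := rfl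

@[simp] theorem onFn_one (F : L.Fn) : PermLang.onFn (1 : L.Γ) F = F := rfl

@[simp] theorem onRel_inv_onRel (g : L.Γ) {k : ℕ} (R : L.Rel k) :
    PermLang.onRel g⁻¹ (PermLang.onRel g R) = R := by
  rw [← onRel_mul, inv_mul_cancel, onRel_one]

@[simp] theorem onFn_inv_onFn (g : L.Γ) (F : L.Fn) :
    PermLang.onFn g⁻¹ (PermLang.onFn g F) = F := by
  rw [← onFn_mul, inv_mul_cancel, onFn_one]

@[simp] theorem onRel_onRel_inv (g : L.Γ) {k : ℕ} (R : L.Rel k) :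
    PermLang.onRel g (PermLang.onRel g⁻¹ R) = R := by
  rw [← onRel_mul, mul_inv_cancel, onRel_one]

@[simp] theorem onFn_onFn_inv (g : L.Γ) (F : L.Fn) :
    PermLang.onFn g (PermLang.onFn g⁻¹ F) = F := by
  rw [← onFn_mul, mul_inv_cancel, onFn_one]

theorem Hom.ext' {f g : Hom A B} (h₁ : f.lang = g.lang) (h₂ : ∀ x, f x = g x) : f = g := by
  cases f; cases g
  obtain rfl := h₁
  obtain rfl := funext h₂
  rfl

namespace Emb

instance : CoeFun (Emb A B) (fun _ => V → W) := ⟨fun f => f.toFun⟩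

theorem ext' {f g : Emb A B} (h₁ : f.lang = g.lang) (h₂ : ∀ x, f x = g x) : f = g := by
  cases f; cases g
  congr
  exact Hom.ext' h₁ h₂

theorem injective (f : Emb A B) : Function.Injective f := f.isEmbedding.injective

theorem mem_rel_iff (f : Emb A B) {k : ℕ} {R : L.Rel k} {x : Fin (k + 1) → V} :
    (fun i => f (x i)) ∈ B.rel (PermLang.onRel f.lang R) ↔ x ∈ A.rel R :=
  (f.isEmbedding.rel_iff R x).symm

theorem image_fn (f : Emb A B) (F : L.Fn) (x : V) :
    f '' A.fn F x = B.fn (PermLang.onFn f.lang F) (f x) := f.isEmbedding.fn_eq F x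

@[simp] theorem comp_apply (g : Emb B C) (f : Emb A B) (x : V) : g.comp f x = g (f x) := rfl

@[simp] theorem comp_lang (g : Emb B C) (f : Emb A B) :
    (g.comp f).lang = g.lang * f.lang := rfl

@[simp] theorem incl_lang (S : Substr A) : S.incl.lang = 1 := rfl

/-- The embedding with language part `g` and vertex part `f`. -/
def ofEq (g : L.Γ) (f : V → W) (hf : Function.Injective f)
    (hrel : ∀ {k : ℕ} (R : L.Rel k) (x : Fin (k + 1) → V),
      x ∈ A.rel R ↔ (fun i => f (x i)) ∈ B.rel (PermLang.onRel g R))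
    (hfn : ∀ F x, f '' A.fn F x = B.fn (PermLang.onFn g F) (f x)) : Emb A B where
  lang := g
  toFun := f
  map_rel R x := (hrel R x).1
  map_fn F x := (hfn F x).subset
  isEmbedding := ⟨hf, hrel, hfn⟩

/-- The identity embedding. -/
def id (A : GStr L V) : Emb A A :=
  ofEq 1 (fun x => x) (fun _ _ h => h) (fun _ _ => Iff.rfl) (fun _ _ => Set.image_id _)

/-- The factor of `i` through `e`, for an embedding `i` with image inside the image of `e`. -/
noncomputable def lift {E : GStr L Z} (e : Emb A B) (i : Emb E B)
    (h : ∀ x, i x ∈ Set.range e) : Emb E A :=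
  have apply : ∀ x, e (h x).choose = i x := fun x => (h x).choose_spec
  ofEq (e.lang⁻¹ * i.lang) (fun x => (h x).choose)
    (fun x y hxy => i.injective (by rw [← apply x, ← apply y]; exact congrArg e hxy))
    (fun R x => by
      rw [← i.mem_rel_iff, ← e.mem_rel_iff, ← onRel_mul, mul_inv_cancel_left]
      simp only [apply])
    (fun F x => by
      apply e.injective.image_injective
      rw [Set.image_image, e.image_fn, ← onFn_mul, mul_inv_cancel_left, apply, ← i.image_fn]
      simp only [apply])

@[simp] theorem lift_lang {E : GStr L Z} (e : Emb A B) (i : Emb E B)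
    (h : ∀ x, i x ∈ Set.range e) : (e.lift i h).lang = e.lang⁻¹ * i.lang := rfl

@[simp] theorem apply_lift {E : GStr L Z} (e : Emb A B) (i : Emb E B)
    (h : ∀ x, i x ∈ Set.range e) (x : Z) : e (e.lift i h x) = i x := (h x).choose_spec

theorem eq_lift {E : GStr L Z} (e : Emb A B) (i : Emb E B) (h : ∀ x, i x ∈ Set.range e)
    {x : Z} {a : V} (ha : e a = i x) : e.lift i h x = a :=
  e.injective ((e.apply_lift i h x).trans ha.symm)

end Emb

end Embeddings

section Closure

variable {W Z : Type*} {B : GStr L W} {E : GStr L Z}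

/-- The closure of a vertex under the functions. -/
def cl (B : GStr L W) (x : W) : Set W :=
  {y | Relation.ReflTransGen (fun a b => ∃ F, b ∈ B.fn F a) x y}

theorem mem_cl_self (B : GStr L W) (x : W) : x ∈ B.cl x := Relation.ReflTransGen.refl

theorem cl_subset_cl {x y : W} (h : y ∈ B.cl x) : B.cl y ⊆ B.cl x :=
  fun _ hz => Relation.ReflTransGen.trans h hz

theorem fn_subset_cl (F : L.Fn) (x : W) : B.fn F x ⊆ B.cl x :=
  fun _ h => Relation.ReflTransGen.single ⟨F, h⟩

theorem Substr.cl_subset (S : Substr B) {x : W} (hx : x ∈ S.carrier) :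
    B.cl x ⊆ S.carrier := by
  intro y hy
  induction hy with
  | refl => exact hx
  | tail _ h ih => exact S.closed _ _ ih h.choose_spec

theorem Hom.map_mem_cl (f : Hom E B) {x y : Z} (h : y ∈ E.cl x) : f y ∈ B.cl (f x) := by
  induction h with
  | refl => exact mem_cl_self _ _
  | tail _ h ih =>
    obtain ⟨F, hF⟩ := h
    exact cl_subset_cl ih (fn_subset_cl _ _ (f.map_fn F _ ⟨_, hF, rfl⟩))

/-- The largest substructure that misses the vertex `z` of `B`, pulled back along `f`. -/
def Hom.avoiding (f : Hom E B) (z : W) : Substr E where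
  carrier := {a | z ∉ B.cl (f a)}
  closed F a ha _ hb hz := ha (cl_subset_cl (fn_subset_cl _ _ (f.map_fn F a ⟨_, hb, rfl⟩)) hz)

end Closure

section Irreducible

variable {Z : Type*} {E : GStr L Z}

theorem Irreducible.eq_univ_or_eq_univ (hE : E.Irreducible) {S T : Substr E}
    (hcover : ∀ x, x ∈ S.carrier ∨ x ∈ T.carrier)
    (hrel : ∀ {k : ℕ} (R : L.Rel k), ∀ x ∈ E.rel R,
      (∀ i, x i ∈ S.carrier) ∨ ∀ i, x i ∈ T.carrier) :
    S.carrier = Set.univ ∨ T.carrier = Set.univ := by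
  by_contra! h
  refine hE ⟨S, T, h.1, h.2, rfl, ?_, Set.eq_univ_of_forall fun x => ?_, ?_⟩
  · rintro ⟨a, ha⟩ ⟨b, hb⟩ (rfl : a = b)
    exact ⟨⟨⟨a, ha, hb⟩, rfl⟩, ⟨⟨a, ha, hb⟩, rfl⟩⟩
  · exact (hcover x).imp (fun hx => ⟨⟨x, hx⟩, rfl⟩) fun hx => ⟨⟨x, hx⟩, rfl⟩
  · rintro k R x ⟨i, ⟨a, ha⟩, ha', hi⟩ ⟨j, ⟨b, hb⟩, hb', hj⟩ hx
    obtain hS | hT := hrel R x hx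
    · exact hb' ⟨⟨b, (show x j = b from hj.symm) ▸ hS j, hb⟩, rfl⟩
    · exact ha' ⟨⟨a, ha, (show x i = a from hi.symm) ▸ hT i⟩, rfl⟩

end Irreducible

/-! ### Atlases -/

variable {V : Type w} {U : Type w₁} {A : GStr L V} {B : GStr L U}

/-- A structure `B` covered with copies of `A`: an embedding `ψ` of `A` in `B`, a group `G` acting
on `B` by automorphisms (with language part `lang`), and, for every partial automorphism `f` of
`A`, an element `φ f` of `G` that extends the corresponding partial automorphism of `ψ(A)`. -/
structure Atlas (A : GStr L V) (B : GStr L U) where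
  G : Type (max u v w₁)
  [group : Group G]
  [action : MulAction G U]
  lang : G →* L.Γ
  smul_mem_rel : ∀ (g : G) {k : ℕ} (R : L.Rel k), ∀ x ∈ B.rel R,
    (fun i => g • x i) ∈ B.rel (PermLang.onRel (lang g) R)
  smul_mem_fn : ∀ (g : G) (F : L.Fn) (x : U), ∀ y ∈ B.fn F x,
    g • y ∈ B.fn (PermLang.onFn (lang g) F) (g • x)
  ψ : Emb A B
  φ : PartialAut A → G
  lang_φ : ∀ f, lang (φ f) = ψ.lang * f.map.lang * ψ.lang⁻¹
  φ_smul : ∀ (f : PartialAut A) (a : f.dom.carrier), φ f • ψ a = ψ (f.map a)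

namespace Atlas

attribute [instance] group action

variable (S : Atlas A B)

/-- The choice of the extensions of partial automorphisms is coherent. -/
def Coherent : Prop := ∀ f g h, CoherentTriple f g h → S.φ h = S.φ g * S.φ f

/-- The automorphism of `B` given by an element of the group. -/
def autEmb (g : S.G) : Emb B B :=
  Emb.ofEq (S.lang g) (g • ·) (MulAction.injective g)
    (fun R x => ⟨S.smul_mem_rel g R x, fun h => by
      simpa only [map_inv, onRel_inv_onRel, inv_smul_smul] using S.smul_mem_rel g⁻¹ _ _ h⟩)
    (fun F x => by
      refine Set.Subset.antisymm (Set.image_subset_iff.2 (S.smul_mem_fn g F x)) fun y hy => ?_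
      refine ⟨g⁻¹ • y, ?_, smul_inv_smul g y⟩
      simpa only [map_inv, onFn_inv_onFn, inv_smul_smul] using S.smul_mem_fn g⁻¹ _ _ y hy)

theorem autEmb_isIso (g : S.G) : (S.autEmb g).toHom.IsIso :=
  { (S.autEmb g).isEmbedding with surjective := MulAction.surjective g }

/-- The embedding of `A` whose image is the copy given by `g`. -/
def chart (g : S.G) : Emb A B := (S.autEmb g).comp S.ψ

/-- The copy of `A` given by `g`. -/
def block (g : S.G) : Substr B := (S.chart g).range

/-- Two vertices lie in a common copy of `A`. -/
def Adj (x y : U) : Prop := ∃ g, x ∈ (S.block g).carrier ∧ y ∈ (S.block g).carrier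

/-- Every vertex and every tuple in a relation lies in a copy of `A`. -/
structure Covered : Prop where
  vertex : ∀ x, ∃ g, x ∈ (S.block g).carrier
  rel : ∀ {k : ℕ} (R : L.Rel k), ∀ x ∈ B.rel R, ∃ g, ∀ i, x i ∈ (S.block g).carrier

/-- Every clique of `Adj` lies in a copy of `A`. -/
def Conformal : Prop :=
  ∀ C : Set U, (∀ x ∈ C, ∀ y ∈ C, S.Adj x y) → ∃ g, C ⊆ (S.block g).carrier

variable {S}

theorem smul_chart (g h : S.G) (a : V) : g • S.chart h a = S.chart (g * h) a :=
  (mul_smul g h _).symm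

@[simp] theorem chart_one (a : V) : S.chart 1 a = S.ψ a := one_smul _ _

theorem smul_mem_block {g h : S.G} {x : U} (hx : x ∈ (S.block h).carrier) :
    g • x ∈ (S.block (g * h)).carrier := by
  obtain ⟨a, rfl⟩ := hx
  exact ⟨a, (smul_chart g h a).symm⟩

theorem smul_cl (g : S.G) (x : U) : g • B.cl x = B.cl (g • x) := by
  refine Set.Subset.antisymm ?_ fun y hy => ?_
  · rintro _ ⟨y, hy, rfl⟩
    exact (S.autEmb g).map_mem_cl hy
  · rw [Set.mem_smul_set_iff_inv_smul_mem, ← inv_smul_smul g x]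
    exact (S.autEmb g⁻¹).map_mem_cl hy

namespace Adj

variable {x y z : U}

theorem symm (h : S.Adj x y) : S.Adj y x := by
  obtain ⟨g, hx, hy⟩ := h
  exact ⟨g, hy, hx⟩

theorem smul (g : S.G) (h : S.Adj x y) : S.Adj (g • x) (g • y) := by
  obtain ⟨k, hx, hy⟩ := h
  exact ⟨g * k, smul_mem_block hx, smul_mem_block hy⟩

theorem cl_right (h : S.Adj x y) (hz : z ∈ B.cl y) : S.Adj x z := by
  obtain ⟨g, hx, hy⟩ := h
  exact ⟨g, hx, (S.block g).cl_subset hy hz⟩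

theorem cl_left (h : S.Adj x y) (hz : z ∈ B.cl x) : S.Adj z y := (h.symm.cl_right hz).symm

end Adj

@[simp] theorem adj_smul_iff (g : S.G) {x y : U} : S.Adj (g • x) (g • y) ↔ S.Adj x y :=
  ⟨fun h => by simpa using h.smul g⁻¹, Adj.smul g⟩

namespace Covered

variable {Z : Type*} {E : GStr L Z}

theorem adj_self (hS : S.Covered) (x : U) : S.Adj x x := by
  obtain ⟨g, hx⟩ := hS.vertex x
  exact ⟨g, hx, hx⟩

/-- If `e p` and `e q` were not adjacent, the vertices of `E` whose closure avoids `e p`, and those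
whose closure avoids `e q`, would be a free amalgamation. -/
theorem adj_of_irreducible (hS : S.Covered) (hE : E.Irreducible) (e : Emb E B) (p q : Z) :
    S.Adj (e p) (e q) := by
  by_contra hpq
  have hcover (a : Z) : a ∈ (e.avoiding (e p)).carrier ∨ a ∈ (e.avoiding (e q)).carrier := by
    by_contra! h
    simp only [Hom.avoiding, Set.mem_ofPred_eq, not_not] at h
    exact hpq (((hS.adj_self _).cl_left h.1).cl_right h.2)
  have hrel {k : ℕ} (R : L.Rel k) (x : Fin (k + 1) → Z) (hx : x ∈ E.rel R) :
      (∀ i, x i ∈ (e.avoiding (e p)).carrier) ∨ ∀ i, x i ∈ (e.avoiding (e q)).carrier := by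
    by_contra! h
    simp only [Hom.avoiding, Set.mem_ofPred_eq, not_not] at h
    obtain ⟨⟨i, hi⟩, ⟨j, hj⟩⟩ := h
    obtain ⟨g, hg⟩ := hS.rel _ _ (e.map_rel R x hx)
    exact hpq ⟨g, (S.block g).cl_subset (hg i) hi, (S.block g).cl_subset (hg j) hj⟩
  obtain h | h := hE.eq_univ_or_eq_univ hcover hrel
  · exact h.symm.subset (Set.mem_univ p) (mem_cl_self _ _)
  · exact h.symm.subset (Set.mem_univ q) (mem_cl_self _ _)

theorem range_subset_block (hS : S.Covered) (hS' : S.Conformal) (hE : E.Irreducible)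
    (e : Emb E B) : ∃ g, Set.range e ⊆ (S.block g).carrier := by
  refine hS' _ ?_
  rintro _ ⟨p, rfl⟩ _ ⟨q, rfl⟩
  exact hS.adj_of_irreducible hE e p q

theorem isFaithfulVia (hS : S.Covered) (hS' : S.Conformal) : IsFaithfulVia S.ψ := by
  intro C hC
  obtain ⟨g, hg⟩ := hS.range_subset_block hS' hC C.incl
  refine ⟨_, S.autEmb_isIso g⁻¹, ?_⟩
  rintro _ ⟨x, hx, rfl⟩
  obtain ⟨a, rfl⟩ := hg ⟨⟨x, hx⟩, rfl⟩
  exact ⟨a, (inv_smul_smul g _).symm⟩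

end Covered

end Atlas

/-! ### Covers by valuations -/

/-- The valuation `a` is pairwise compatible on `Q`, with respect to the constraint `r`. -/
def CompatOn {X : Type*} (r : U → X → U → X → Prop) (Q : Set U) (a : U → X) : Prop :=
  ∀ y ∈ Q, ∀ y' ∈ Q, r y (a y) y' (a y')

/-- Valuation constraints on `B`: for every index `i`, the vertices in `supp i` are to be decorated
by values in `X` subject to the binary constraint `Compat i`. The copy `ψ(A)` carries the standard
valuation `std`, and `ext g i Q a b` permutes the values so that the valuation `a` of `Q` becomes
the valuation `b` of `g • Q`. -/
structure LocalSystem (S : Atlas A B) (I : Type w₁) (X : Type) [MulAction S.G I] where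
  supp : I → Set U
  supp_smul : ∀ (g : S.G) (i : I), supp (g • i) = g • supp i
  Compat : I → U → X → U → X → Prop
  std : I → U → X
  std_compat : ∀ i, CompatOn (Compat i) (Set.range S.ψ ∩ supp i) (std i)
  ext : S.G → I → Set U → (U → X) → (U → X) → Perm X
  ext_apply : ∀ {g i Q a b}, Q ⊆ Set.range S.ψ → CompatOn (Compat i) Q a →
    CompatOn (Compat (g • i)) (g • Q) b →
    ∀ y ∈ Q, ext g i Q a b (a y) = b (g • y)
  compat_ext_iff : ∀ {g i Q a b}, Q ⊆ Set.range S.ψ → CompatOn (Compat i) Q a →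
    CompatOn (Compat (g • i)) (g • Q) b → ∀ y u y' u',
      Compat (g • i) (g • y) (ext g i Q a b u) (g • y') (ext g i Q a b u') ↔ Compat i y u y' u'
  ext_mul : ∀ {g h i Q a b c}, Q ⊆ Set.range S.ψ → CompatOn (Compat i) Q a →
    CompatOn (Compat (g • i)) (g • Q) b → CompatOn (Compat ((h * g) • i)) ((h * g) • Q) c →
      ext (h * g) i Q a c = ext h (g • i) (g • Q) b c * ext g i Q a b

namespace LocalSystem

variable {S : Atlas A B} {I : Type w₁} {X : Type} [MulAction S.G I] (Λ : LocalSystem S I X)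

/-- Two decorations, i.e. vertices with an index and a value, have the same index and satisfy the
constraint. -/
def DecCompat (p q : U × I × X) : Prop :=
  p.2.1 = q.2.1 ∧ Λ.Compat p.2.1 p.1 p.2.2 q.1 q.2.2

/-- The lifts of elements of the group of the atlas to permutations of the decorations. -/
def coverGroup : Subgroup (S.G × Perm (U × I × X)) where
  carrier := {g | (∀ p, (g.2 p).1 = g.1 • p.1) ∧ (∀ p, (g.2 p).2.1 = g.1 • p.2.1) ∧
    ∀ p q, Λ.DecCompat (g.2 p) (g.2 q) ↔ Λ.DecCompat p q}
  one_mem' := ⟨fun p => (one_smul _ p.1).symm, fun p => (one_smul _ p.2.1).symm,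
    fun _ _ => Iff.rfl⟩
  mul_mem' := by
    rintro g h ⟨hg₁, hg₂, hg₃⟩ ⟨hh₁, hh₂, hh₃⟩
    refine ⟨fun p => ?_, fun p => ?_, fun p q => (hg₃ _ _).trans (hh₃ p q)⟩
    · exact (hg₁ _).trans (by rw [hh₁, ← mul_smul]; rfl)
    · exact (hg₂ _).trans (by rw [hh₂, ← mul_smul]; rfl)
  inv_mem' := by
    rintro g ⟨hg₁, hg₂, hg₃⟩
    refine ⟨fun p => ?_, fun p => ?_, fun p q => ?_⟩
    · rw [Prod.fst_inv, eq_inv_smul_iff, ← hg₁, Prod.snd_inv, Perm.coe_inv, apply_symm_apply]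
    · rw [Prod.fst_inv, eq_inv_smul_iff, ← hg₂, Prod.snd_inv, Perm.coe_inv, apply_symm_apply]
    · rw [← hg₃, Prod.snd_inv, Perm.coe_inv, apply_symm_apply, apply_symm_apply]

/-- The decorations of the vertices in `P` by the valuation `k`. -/
def graph (k : I → U → X) (P : Set U) : Set (U × I × X) :=
  {p | p.1 ∈ P ∧ p.1 ∈ Λ.supp p.2.1 ∧ p.2.2 = k p.2.1 p.1}

/-- The vertex `y` together with the decorations of its closure by the valuation `k`. -/
def sect (k : I → U → X) (y : U) : U × Set (U × I × X) := (y, Λ.graph k (B.cl y))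

/-- The action of the lifts on vertices with a set of decorations. -/
def act (g : Λ.coverGroup) (v : U × Set (U × I × X)) : U × Set (U × I × X) :=
  (g.1.1 • v.1, g.1.2 '' v.2)

/-- The valuation `k` transported along `g`. -/
def push (g : Λ.coverGroup) (k : I → U → X) : I → U → X :=
  fun i y => (g.1.2 (g.1.1⁻¹ • y, g.1.1⁻¹ • i, k (g.1.1⁻¹ • i) (g.1.1⁻¹ • y))).2.2

/-- The vertices of the copy of `A` in the cover given by `g`. -/
def coverBlock (g : Λ.coverGroup) : Set (U × Set (U × I × X)) :=
  Λ.sect (Λ.push g Λ.std) '' (S.block g.1.1).carrier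

variable {Λ}

theorem sect_eq_sect {k k' : I → U → X} {y : U}
    (h : ∀ i, ∀ z ∈ B.cl y ∩ Λ.supp i, k i z = k' i z) : Λ.sect k y = Λ.sect k' y :=
  Prod.ext rfl <| Set.ext fun p => and_congr_right fun h₁ => and_congr_right fun h₂ => by
    rw [h p.2.1 p.1 ⟨h₁, h₂⟩]

theorem graph_restrict (k : I → U → X) {P Q : Set U} (h : Q ⊆ P) :
    {p ∈ Λ.graph k P | p.1 ∈ Q} = Λ.graph k Q :=
  Set.ext fun _ => ⟨fun hp => ⟨hp.2, hp.1.2⟩, fun hp => ⟨⟨h hp.1, hp.2⟩, hp.1⟩⟩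

theorem apply_dec (g : Λ.coverGroup) (k : I → U → X) (y : U) (i : I) :
    g.1.2 (y, i, k i y) = (g.1.1 • y, g.1.1 • i, Λ.push g k (g.1.1 • i) (g.1.1 • y)) := by
  refine Prod.ext (g.2.1 _) (Prod.ext (g.2.2.1 _) ?_)
  simp only [push, inv_smul_smul]

theorem smul_mem_supp_iff (g : S.G) {i : I} {y : U} : g • y ∈ Λ.supp (g • i) ↔ y ∈ Λ.supp i := by
  rw [Λ.supp_smul, Set.smul_mem_smul_set_iff]

theorem image_graph (g : Λ.coverGroup) (k : I → U → X) (P : Set U) :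
    g.1.2 '' Λ.graph k P = Λ.graph (Λ.push g k) (g.1.1 • P) := by
  ext ⟨y, i, u⟩
  constructor
  · rintro ⟨⟨y, i, u⟩, ⟨h₁, h₂, h₃⟩, h⟩
    obtain rfl : u = k i y := h₃
    rw [← h, apply_dec]
    exact ⟨Set.smul_mem_smul_set h₁, (smul_mem_supp_iff _).2 h₂, rfl⟩
  · rintro ⟨⟨y, h₁, rfl⟩, h₂, h₃⟩
    obtain ⟨i, rfl⟩ := MulAction.surjective g.1.1 i
    obtain rfl : u = Λ.push g k (g.1.1 • i) (g.1.1 • y) := h₃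
    exact ⟨(y, i, k i y), ⟨h₁, (smul_mem_supp_iff _).1 h₂, rfl⟩, apply_dec g k y i⟩

theorem act_sect (g : Λ.coverGroup) (k : I → U → X) (y : U) :
    Λ.act g (Λ.sect k y) = Λ.sect (Λ.push g k) (g.1.1 • y) :=
  Prod.ext rfl ((image_graph g k _).trans (congrArg _ (Atlas.smul_cl _ _)))

@[simp] theorem push_one (k : I → U → X) : Λ.push 1 k = k := by
  funext i y
  simp [push]

theorem push_mul (g h : Λ.coverGroup) (k : I → U → X) :
    Λ.push (g * h) k = Λ.push g (Λ.push h k) := by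
  funext i y
  obtain ⟨z, rfl⟩ := MulAction.surjective (g * h).1.1 y
  obtain ⟨j, rfl⟩ := MulAction.surjective (g * h).1.1 i
  have e := apply_dec (g * h) k z j
  change g.1.2 (h.1.2 (z, j, k j z)) = _ at e
  rw [apply_dec h, apply_dec g, ← mul_smul, ← mul_smul] at e
  exact congrArg (fun p => p.2.2) e.symm

theorem act_mem_coverBlock (g : Λ.coverGroup) {h : Λ.coverGroup} {v : U × Set (U × I × X)}
    (hv : v ∈ Λ.coverBlock h) : Λ.act g v ∈ Λ.coverBlock (g * h) := by
  obtain ⟨y, hy, rfl⟩ := hv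
  rw [act_sect, ← push_mul]
  exact ⟨_, Atlas.smul_mem_block hy, rfl⟩

theorem compatOn_push (g : Λ.coverGroup) (i : I) :
    CompatOn (Λ.Compat i) ((S.block g.1.1).carrier ∩ Λ.supp i) (Λ.push g Λ.std i) := by
  rintro _ ⟨⟨a, rfl⟩, ha⟩ _ ⟨⟨b, rfl⟩, hb⟩
  obtain ⟨j, rfl⟩ := MulAction.surjective g.1.1 i
  have hj : Λ.DecCompat (S.ψ a, j, Λ.std j (S.ψ a)) (S.ψ b, j, Λ.std j (S.ψ b)) :=
    ⟨rfl, Λ.std_compat j _ ⟨⟨a, rfl⟩, (smul_mem_supp_iff _).1 ha⟩ _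
      ⟨⟨b, rfl⟩, (smul_mem_supp_iff _).1 hb⟩⟩
  rw [← g.2.2.2, apply_dec, apply_dec] at hj
  exact hj.2

variable (Λ) in
/-- The vertices of the cover. -/
def CoverVertex : Type w₁ := {v : U × Set (U × I × X) // ∃ g, v ∈ Λ.coverBlock g}

theorem finite_coverVertex [Finite U] [Finite I] [Finite X] : Finite Λ.CoverVertex :=
  Subtype.finite

instance : MulAction Λ.coverGroup Λ.CoverVertex where
  smul g v := ⟨Λ.act g v.1, v.2.imp' (g * ·) fun _ => act_mem_coverBlock g⟩
  one_smul v := Subtype.ext (by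
    change Λ.act 1 v.1 = v.1
    simp [act])
  mul_smul g h v := Subtype.ext (by
    change Λ.act (g * h) v.1 = Λ.act g (Λ.act h v.1)
    simp only [act, Subgroup.coe_mul, Prod.fst_mul, Prod.snd_mul, mul_smul, Perm.coe_mul,
      Set.image_comp])

theorem coe_smul (g : Λ.coverGroup) (v : Λ.CoverVertex) : (g • v).1 = Λ.act g v.1 := rfl

variable (Λ) in
/-- The cover of `B` given by a system of valuations: its vertices are the vertices of `B` with a
valuation of their closure. -/
def coverStr : GStr L Λ.CoverVertex where
  rel R := {v | (fun i => (v i).1.1) ∈ B.rel R ∧ ∃ g, ∀ i, (v i).1 ∈ Λ.coverBlock g}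
  fn F v := {w | w.1.1 ∈ B.fn F v.1.1 ∧ w.1.2 = {p ∈ v.1.2 | p.1 ∈ B.cl w.1.1}}

theorem mem_coverStr_fn {F : L.Fn} {v w : Λ.CoverVertex} {k : I → U → X} {y : U}
    (hv : v.1 = Λ.sect k y) :
    w ∈ Λ.coverStr.fn F v ↔ w.1.1 ∈ B.fn F y ∧ w.1 = Λ.sect k w.1.1 := by
  have hfst : v.1.1 = y := by rw [hv]; rfl
  have hsnd : v.1.2 = Λ.graph k (B.cl y) := by rw [hv]; rfl
  simp only [coverStr, Set.mem_ofPred_eq, hfst, hsnd]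
  refine and_congr_right fun h => ?_
  rw [graph_restrict k (cl_subset_cl (fn_subset_cl _ _ h))]
  exact ⟨fun h' => Prod.ext rfl h', fun h' => congrArg Prod.snd h'⟩

theorem smul_mem_coverStr_rel (g : Λ.coverGroup) {k : ℕ} (R : L.Rel k)
    (x : Fin (k + 1) → Λ.CoverVertex) (hx : x ∈ Λ.coverStr.rel R) :
    (fun i => g • x i) ∈ Λ.coverStr.rel (PermLang.onRel (S.lang g.1.1) R) := by
  obtain ⟨h₁, h, h₂⟩ := hx
  exact ⟨S.smul_mem_rel _ _ _ h₁, g * h, fun i => act_mem_coverBlock g (h₂ i)⟩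

theorem smul_mem_coverStr_fn (g : Λ.coverGroup) (F : L.Fn) (v w : Λ.CoverVertex)
    (hw : w ∈ Λ.coverStr.fn F v) :
    g • w ∈ Λ.coverStr.fn (PermLang.onFn (S.lang g.1.1) F) (g • v) := by
  obtain ⟨h, y, -, hy⟩ := v.2
  obtain ⟨h₁, h₂⟩ := (mem_coverStr_fn hy.symm).1 hw
  refine (mem_coverStr_fn (k := Λ.push g (Λ.push h Λ.std)) (y := g.1.1 • y) ?_).2
    ⟨S.smul_mem_fn _ _ _ _ h₁, ?_⟩
  · rw [coe_smul, ← hy, act_sect]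
  · rw [coe_smul, h₂, act_sect]
    rfl

variable (Λ) in
/-- The vertex of the cover given by a vertex of `A` with the standard valuation. -/
def stdVertex (a : V) : Λ.CoverVertex :=
  ⟨Λ.sect Λ.std (S.ψ a), 1, by
    rw [coverBlock, push_one]
    exact ⟨_, ⟨a, one_smul _ _⟩, rfl⟩⟩

theorem image_stdVertex_fn (F : L.Fn) (a : V) :
    Λ.stdVertex '' A.fn F a = Λ.coverStr.fn (PermLang.onFn S.ψ.lang F) (Λ.stdVertex a) := by
  ext w
  rw [mem_coverStr_fn rfl, ← S.ψ.image_fn]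
  constructor
  · rintro ⟨b, hb, rfl⟩
    exact ⟨⟨b, hb, rfl⟩, rfl⟩
  · rintro ⟨⟨b, hb, h⟩, hw⟩
    exact ⟨b, hb, Subtype.ext (by rw [hw, ← h]; rfl)⟩

variable (Λ) in
/-- The copy of `A` in the cover. -/
def coverEmb : Emb A Λ.coverStr :=
  Emb.ofEq S.ψ.lang Λ.stdVertex
    (fun _ _ h => S.ψ.injective (congrArg (fun v : Λ.CoverVertex => v.1.1) h))
    (fun R x => ⟨fun hx => ⟨S.ψ.map_rel R x hx, 1, fun i => by
        rw [coverBlock, push_one]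
        exact ⟨_, ⟨x i, one_smul _ _⟩, rfl⟩⟩, fun hx => S.ψ.mem_rel_iff.1 hx.1⟩)
    image_stdVertex_fn

/-- The permutation of the decorations over `g` that permutes the values at `i` by `σ i`. -/
def decPerm (g : S.G) (σ : I → Perm X) : Perm (U × I × X) where
  toFun p := (g • p.1, g • p.2.1, σ p.2.1 p.2.2)
  invFun p := (g⁻¹ • p.1, g⁻¹ • p.2.1, (σ (g⁻¹ • p.2.1)).symm p.2.2)
  left_inv p := by simp only [inv_smul_smul, symm_apply_apply]
  right_inv p := by simp only [smul_inv_smul, apply_symm_apply]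

variable (Λ) in
/-- The lift of `g` that turns the standard valuation of `Q` into the valuation `b` of `g • Q`. -/
def liftOf (g : S.G) (Q : Set U) (b : I → U → X) : S.G × Perm (U × I × X) :=
  (g, decPerm g fun i => Λ.ext g i (Q ∩ Λ.supp i) (Λ.std i) (b (g • i)))

variable (Λ) in
/-- The conditions under which `liftOf g Q b` is in the group of the cover. -/
structure Liftable (g : S.G) (Q : Set U) (b : I → U → X) : Prop where
  subset : Q ⊆ Set.range S.ψ
  compat : ∀ i, CompatOn (Λ.Compat i) (g • Q ∩ Λ.supp i) (b i)

theorem smul_inter_supp (g : S.G) (Q : Set U) (i : I) :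
    g • (Q ∩ Λ.supp i) = g • Q ∩ Λ.supp (g • i) := by
  rw [Set.smul_set_inter, Λ.supp_smul]

namespace Liftable

variable {g : S.G} {Q : Set U} {b : I → U → X}

theorem inter_subset (hb : Λ.Liftable g Q b) (i : I) : Q ∩ Λ.supp i ⊆ Set.range S.ψ :=
  fun _ hy => hb.subset hy.1

theorem compatOn_std (hb : Λ.Liftable g Q b) (i : I) :
    CompatOn (Λ.Compat i) (Q ∩ Λ.supp i) (Λ.std i) :=
  fun _ hy _ hy' => Λ.std_compat i _ ⟨hb.subset hy.1, hy.2⟩ _ ⟨hb.subset hy'.1, hy'.2⟩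

theorem compatOn_smul (hb : Λ.Liftable g Q b) (i : I) :
    CompatOn (Λ.Compat (g • i)) (g • (Q ∩ Λ.supp i)) (b (g • i)) := by
  rw [smul_inter_supp]
  exact hb.compat _

theorem liftOf_mem (hb : Λ.Liftable g Q b) : Λ.liftOf g Q b ∈ Λ.coverGroup := by
  refine ⟨fun _ => rfl, fun _ => rfl, ?_⟩
  rintro ⟨y, i, u⟩ ⟨y', j, u'⟩
  refine (and_congr_left' (MulAction.injective g).eq_iff).trans (and_congr_right ?_)
  rintro (rfl : i = j)
  exact Λ.compat_ext_iff (hb.inter_subset i) (hb.compatOn_std i) (hb.compatOn_smul i) y u y' u'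

/-- `liftOf g Q b` as an element of the group of the cover. -/
def lift (hb : Λ.Liftable g Q b) : Λ.coverGroup := ⟨Λ.liftOf g Q b, hb.liftOf_mem⟩

theorem push_lift (hb : Λ.Liftable g Q b) {i : I} {y : U} (hy : y ∈ g • Q ∩ Λ.supp i) :
    Λ.push hb.lift Λ.std i y = b i y := by
  obtain ⟨⟨y, hQ, rfl⟩, hi⟩ := hy
  obtain ⟨i, rfl⟩ := MulAction.surjective g i
  have hmem : y ∈ Q ∩ Λ.supp i := ⟨hQ, (smul_mem_supp_iff g).1 hi⟩
  have hpush := congrArg (fun p => p.2.2) (apply_dec hb.lift Λ.std y i)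
  exact hpush.symm.trans
    (Λ.ext_apply (hb.inter_subset i) (hb.compatOn_std i) (hb.compatOn_smul i) y hmem)

end Liftable

theorem smul_image_dom (f : PartialAut A) :
    S.φ f • (S.ψ '' f.dom.carrier) = S.ψ '' f.ran.carrier := by
  ext y
  constructor
  · rintro ⟨_, ⟨a, ha, rfl⟩, rfl⟩
    exact ⟨_, (f.map ⟨a, ha⟩).2, (S.φ_smul f ⟨a, ha⟩).symm⟩
  · rintro ⟨b, hb, rfl⟩
    obtain ⟨a, ha⟩ := f.isIso.surjective ⟨b, hb⟩
    refine ⟨_, ⟨a, a.2, rfl⟩, (S.φ_smul f a).trans ?_⟩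
    rw [show f.map a = ⟨b, hb⟩ from ha]

theorem liftable_std (f : PartialAut A) : Λ.Liftable (S.φ f) (S.ψ '' f.dom.carrier) Λ.std where
  subset := Set.image_subset_range _ _
  compat i := by
    rw [smul_image_dom]
    exact fun y hy y' hy' => Λ.std_compat i y ⟨Set.image_subset_range _ _ hy.1, hy.2⟩
      y' ⟨Set.image_subset_range _ _ hy'.1, hy'.2⟩

variable (Λ)

/-- The cover of `B` as an atlas. -/
def cover : Atlas A Λ.coverStr where
  G := Λ.coverGroup
  lang := S.lang.comp ((MonoidHom.fst _ _).comp Λ.coverGroup.subtype)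
  smul_mem_rel := smul_mem_coverStr_rel
  smul_mem_fn := smul_mem_coverStr_fn
  ψ := Λ.coverEmb
  φ f := (liftable_std f).lift
  lang_φ f := S.lang_φ f
  φ_smul f a := by
    refine Subtype.ext ((act_sect _ _ _).trans ?_)
    change Λ.sect _ (S.φ f • S.ψ a) = Λ.sect Λ.std (S.ψ (f.map a))
    rw [S.φ_smul]
    refine sect_eq_sect fun i z hz => (liftable_std f).push_lift ⟨?_, hz.2⟩
    rw [smul_image_dom]
    obtain ⟨b, hb, rfl⟩ := (S.ψ.comp f.ran.incl).range.cl_subset ⟨f.map a, rfl⟩ hz.1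
    exact ⟨_, b.2, rfl⟩

theorem cover_coherent (hS : S.Coherent) : Λ.cover.Coherent := by
  intro f g h hfgh
  have hφ := hS f g h hfgh
  refine Subtype.ext (Prod.ext hφ (Equiv.ext fun ⟨y, i, u⟩ => ?_))
  have hmid : S.ψ '' g.dom.carrier = S.φ f • (S.ψ '' f.dom.carrier) := by
    rw [smul_image_dom, hfgh.mid_eq]
  have hf := liftable_std (Λ := Λ) f
  have hh := (liftable_std (Λ := Λ) h).compatOn_smul i
  rw [hφ, ← hfgh.dom_eq] at hh
  have hext := Λ.ext_mul (hf.inter_subset i) (hf.compatOn_std i) (hf.compatOn_smul i) hh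
  refine Prod.ext ?_ (Prod.ext ?_ ?_)
  · exact (congrArg (· • y) hφ).trans (mul_smul _ _ _)
  · exact (congrArg (· • i) hφ).trans (mul_smul _ _ _)
  · change Λ.ext (S.φ h) i (S.ψ '' h.dom.carrier ∩ Λ.supp i) (Λ.std i) (Λ.std (S.φ h • i)) u =
      Λ.ext (S.φ g) (S.φ f • i) (S.ψ '' g.dom.carrier ∩ Λ.supp (S.φ f • i)) _ _
        (Λ.ext (S.φ f) i (S.ψ '' f.dom.carrier ∩ Λ.supp i) _ _ u)
    rw [hφ, ← hfgh.dom_eq, hmid, ← smul_inter_supp, hext, mul_smul]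
    rfl

variable {Λ}

theorem coe_cover_chart (g : Λ.coverGroup) (a : V) :
    (Λ.cover.chart g a).1 = Λ.sect (Λ.push g Λ.std) (S.chart g.1.1 a) := act_sect _ _ _

theorem mem_cover_block_iff {g : Λ.coverGroup} {v : Λ.CoverVertex} :
    v ∈ (Λ.cover.block g).carrier ↔ v.1 ∈ Λ.coverBlock g := by
  constructor
  · rintro ⟨a, rfl⟩
    exact ⟨_, ⟨a, rfl⟩, (coe_cover_chart g a).symm⟩
  · rintro ⟨_, ⟨a, rfl⟩, h⟩
    exact ⟨a, Subtype.ext ((coe_cover_chart g a).trans h)⟩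

variable (Λ)

theorem cover_covered : Λ.cover.Covered where
  vertex v := v.2.imp fun _ => mem_cover_block_iff.2
  rel _ _ hv := hv.2.imp fun _ hg i => mem_cover_block_iff.2 (hg i)

variable {Λ}

theorem adj_of_cover_adj {v w : Λ.CoverVertex} (h : Λ.cover.Adj v w) : S.Adj v.1.1 w.1.1 := by
  obtain ⟨g, ⟨a, rfl⟩, ⟨b, rfl⟩⟩ := h
  exact ⟨g.1.1, ⟨a, rfl⟩, ⟨b, rfl⟩⟩

theorem eq_of_mem_snd {g : Λ.coverGroup} {v : U × Set (U × I × X)} (h : v ∈ Λ.coverBlock g)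
    {y : U} {i : I} {u : X} (hu : (y, i, u) ∈ v.2) :
    y ∈ (S.block g.1.1).carrier ∩ Λ.supp i ∧ u = Λ.push g Λ.std i y := by
  obtain ⟨z, hz, rfl⟩ := h
  exact ⟨⟨(S.block g.1.1).cl_subset hz hu.1, hu.2.1⟩, hu.2.2⟩

theorem dec_of_adj {v w : Λ.CoverVertex} (h : Λ.cover.Adj v w) {i : I} {y y' : U} {u u' : X}
    (hv : (y, i, u) ∈ v.1.2) (hw : (y', i, u') ∈ w.1.2) :
    Λ.Compat i y u y' u' ∧ (y = y' → u = u') := by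
  obtain ⟨g, hgv, hgw⟩ := h
  obtain ⟨hy, rfl⟩ := eq_of_mem_snd (mem_cover_block_iff.1 hgv) hv
  obtain ⟨hy', rfl⟩ := eq_of_mem_snd (mem_cover_block_iff.1 hgw) hw
  refine ⟨compatOn_push g i y hy y' hy', ?_⟩
  rintro rfl
  rfl

theorem exists_mem_snd (v : Λ.CoverVertex) {i : I} {y : U} (hy : y ∈ B.cl v.1.1 ∩ Λ.supp i) :
    ∃ u, (y, i, u) ∈ v.1.2 := by
  obtain ⟨g, z, -, hz⟩ := v.2
  rw [← hz] at hy ⊢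
  exact ⟨Λ.push g Λ.std i y, hy.1, hy.2, rfl⟩

theorem exists_valuation {C : Set Λ.CoverVertex} (hC : ∀ v ∈ C, ∀ w ∈ C, Λ.cover.Adj v w) :
    ∃ b : I → U → X, (∀ i, CompatOn (Λ.Compat i) ((⋃ v ∈ C, B.cl v.1.1) ∩ Λ.supp i) (b i)) ∧
      ∀ v ∈ C, v.1 = Λ.sect b v.1.1 := by
  have hex (i : I) (y : U) : ∃ u, ∀ v ∈ C, y ∈ B.cl v.1.1 ∩ Λ.supp i → (y, i, u) ∈ v.1.2 := by
    by_cases hy : ∃ v ∈ C, y ∈ B.cl v.1.1 ∩ Λ.supp i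
    · obtain ⟨v, hv, hyv⟩ := hy
      obtain ⟨u, hu⟩ := exists_mem_snd v hyv
      refine ⟨u, fun w hw hyw => ?_⟩
      obtain ⟨u', hu'⟩ := exists_mem_snd w hyw
      rwa [(dec_of_adj (hC v hv w hw) hu hu').2 rfl]
    · exact ⟨Λ.std i y, fun v hv hyv => (hy ⟨v, hv, hyv⟩).elim⟩
  choose b hb using hex
  refine ⟨b, ?_, fun v hv => ?_⟩
  · rintro i y ⟨hy, hi⟩ y' ⟨hy', hi'⟩
    obtain ⟨v, hv, hyv⟩ := Set.mem_iUnion₂.1 hy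
    obtain ⟨w, hw, hyw⟩ := Set.mem_iUnion₂.1 hy'
    exact (dec_of_adj (hC v hv w hw) (hb i y v hv ⟨hyv, hi⟩) (hb i y' w hw ⟨hyw, hi'⟩)).1
  · obtain ⟨g, z, -, hz⟩ := v.2
    rw [← hz]
    refine sect_eq_sect fun i y hy => ?_
    have hmem := hb i y v hv (by rwa [← hz])
    rw [← hz] at hmem
    exact hmem.2.2.symm

theorem cover_conformal (h : ∀ C : Set Λ.CoverVertex, (∀ v ∈ C, ∀ w ∈ C, Λ.cover.Adj v w) →
    ∃ g, ∀ v ∈ C, v.1.1 ∈ (S.block g).carrier) : Λ.cover.Conformal := by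
  intro C hC
  obtain ⟨g, hg⟩ := h C hC
  obtain ⟨b, hb, hCb⟩ := exists_valuation hC
  have hlift : Λ.Liftable g (g⁻¹ • ⋃ v ∈ C, B.cl v.1.1) b := by
    refine ⟨?_, by rwa [smul_inv_smul]⟩
    rw [Set.smul_set_subset_iff_subset_inv_smul_set, inv_inv]
    refine Set.iUnion₂_subset fun v hv => ((S.block g).cl_subset (hg v hv)).trans ?_
    rintro _ ⟨a, rfl⟩
    exact ⟨_, ⟨a, rfl⟩, rfl⟩
  refine ⟨hlift.lift, fun v hv => mem_cover_block_iff.2 ⟨v.1.1, hg v hv, ?_⟩⟩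
  refine (sect_eq_sect fun i y hy => hlift.push_lift ⟨?_, hy.2⟩).trans (hCb v hv).symm
  rw [smul_inv_smul]
  exact Set.mem_biUnion hv hy.1

end LocalSystem

/-! ### Injective valuations -/

section Relabel

variable {Y X N : Type*}

open Classical in
/-- The permutation `σ` with `ν' (σ u) = π (ν u)` for all `u`, if there is one. -/
noncomputable def relabel (ν ν' : X → N) (π : N → N) : Perm X :=
  if h : ∃ σ : Perm X, ∀ u, ν' (σ u) = π (ν u) then h.choose else 1

theorem apply_relabel {ν ν' : X → N} {π : N → N} (hν : Function.Injective ν)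
    (hν' : Function.Injective ν') (hπ : Function.Injective π)
    (h : Set.range ν' = π '' Set.range ν) (u : X) : ν' (relabel ν ν' π u) = π (ν u) := by
  have hex : ∃ σ : Perm X, ∀ u, ν' (σ u) = π (ν u) := by
    have hrange : Set.range (π ∘ ν) = Set.range ν' := by rw [h, Set.range_comp]
    refine ⟨(ofInjective _ (hπ.comp hν)).trans
      ((setCongr hrange).trans (ofInjective _ hν').symm), fun u => ?_⟩
    exact apply_ofInjective_symm hν' _
  rw [relabel, dif_pos hex]
  exact hex.choose_spec u

theorem exists_bijOn_Iio [Finite X] (R : Set X) : ∃ r : X → ℕ, Set.BijOn r R (Set.Iio R.ncard) :=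
  R.toFinite.exists_bijOn_of_encard_eq (by
    rw [← R.toFinite.cast_ncard_eq, ← (Set.finite_Iio R.ncard).cast_ncard_eq, Set.ncard_Iio_nat])

/-- A numbering of the elements of a finite set, starting from `0`. -/
noncomputable def rank [Finite X] (R : Set X) : X → ℕ := (exists_bijOn_Iio R).choose

theorem bijOn_rank [Finite X] (R : Set X) : Set.BijOn (rank R) R (Set.Iio R.ncard) :=
  (exists_bijOn_Iio R).choose_spec

open Classical in
/-- Names for the elements of `X`: an element `a y` with `y ∈ Q` is named by `y`, the other elements
of `T` are numbered, and the elements outside `T` keep their names. -/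
noncomputable def label [Finite X] (T : Set X) (Q : Set Y) (a : Y → X) (u : X) : Y ⊕ ℕ ⊕ X :=
  if h : u ∈ a '' Q then .inl h.choose
  else if u ∈ T then .inr (.inl (rank (T \ a '' Q) u)) else .inr (.inr u)

variable [Finite X] {T : Set X} {Q : Set Y} {a : Y → X}

theorem label_apply (ha : Set.InjOn a Q) {y : Y} (hy : y ∈ Q) : label T Q a (a y) = .inl y := by
  have h : a y ∈ a '' Q := ⟨y, hy, rfl⟩
  rw [label, dif_pos h, ha h.choose_spec.1 hy h.choose_spec.2]

theorem label_of_mem {u : X} (hu : u ∈ T \ a '' Q) :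
    label T Q a u = .inr (.inl (rank (T \ a '' Q) u)) := by
  rw [label, dif_neg hu.2, if_pos hu.1]

theorem label_of_notMem (haT : Set.MapsTo a Q T) {u : X} (hu : u ∉ T) :
    label T Q a u = .inr (.inr u) := by
  rw [label, dif_neg fun h => hu (haT.image_subset h), if_neg hu]

theorem label_cases (ha : Set.InjOn a Q) (haT : Set.MapsTo a Q T) (u : X) :
    (∃ y ∈ Q, a y = u ∧ label T Q a u = .inl y) ∨
    (u ∈ T \ a '' Q ∧ label T Q a u = .inr (.inl (rank (T \ a '' Q) u))) ∨
    (u ∉ T ∧ label T Q a u = .inr (.inr u)) := by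
  by_cases hu : u ∈ a '' Q
  · obtain ⟨y, hy, rfl⟩ := hu
    exact .inl ⟨y, hy, rfl, label_apply ha hy⟩
  by_cases huT : u ∈ T
  · exact .inr (.inl ⟨⟨huT, hu⟩, label_of_mem ⟨huT, hu⟩⟩)
  · exact .inr (.inr ⟨huT, label_of_notMem haT huT⟩)

theorem label_injective (ha : Set.InjOn a Q) (haT : Set.MapsTo a Q T) :
    Function.Injective (label T Q a) := by
  intro u v huv
  obtain ⟨y, -, rfl, h⟩ | ⟨hu, h⟩ | ⟨-, h⟩ := label_cases ha haT u <;>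
  obtain ⟨z, -, rfl, h'⟩ | ⟨hv, h'⟩ | ⟨-, h'⟩ := label_cases ha haT v <;>
  simp only [h, h', Sum.inl.injEq, Sum.inr.injEq, reduceCtorEq] at huv
  · rw [huv]
  · exact (bijOn_rank _).injOn hu hv huv
  · exact huv

theorem range_label (ha : Set.InjOn a Q) (haT : Set.MapsTo a Q T) :
    Set.range (label T Q a) = Sum.inl '' Q ∪
      (Sum.inr ∘ Sum.inl) '' Set.Iio (T.ncard - Q.ncard) ∪ (Sum.inr ∘ Sum.inr) '' Tᶜ := by
  have hcard : (T \ a '' Q).ncard = T.ncard - Q.ncard := by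
    rw [Set.ncard_sdiff haT.image_subset, ha.ncard_image]
  rw [← hcard, ← (bijOn_rank _).image_eq]
  ext n
  constructor
  · rintro ⟨u, rfl⟩
    obtain ⟨y, hy, -, h⟩ | ⟨hu, h⟩ | ⟨hu, h⟩ := label_cases ha haT u <;> rw [h]
    · exact .inl (.inl ⟨y, hy, rfl⟩)
    · exact .inl (.inr ⟨_, ⟨u, hu, rfl⟩, rfl⟩)
    · exact .inr ⟨u, hu, rfl⟩
  · rintro ((⟨y, hy, rfl⟩ | ⟨_, ⟨u, hu, rfl⟩, rfl⟩) | ⟨u, hu, rfl⟩)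
    · exact ⟨a y, label_apply ha hy⟩
    · exact ⟨u, label_of_mem hu⟩
    · exact ⟨u, label_of_notMem haT hu⟩

theorem mem_iff_of_label_eq {Q' : Set Y} {b : Y → X} (ha : Set.InjOn a Q)
    (haT : Set.MapsTo a Q T) (hb : Set.InjOn b Q') (hbT : Set.MapsTo b Q' T) {f : Y → Y} {u v : X}
    (h : label T Q' b v = (label T Q a u).map f id) : v ∈ T ↔ u ∈ T := by
  obtain ⟨y, hy, rfl, h₁⟩ | ⟨hu, h₁⟩ | ⟨hu, h₁⟩ := label_cases ha haT u <;>
  obtain ⟨z, hz, rfl, h₂⟩ | ⟨hv, h₂⟩ | ⟨hv, h₂⟩ := label_cases hb hbT v <;>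
  simp only [h₁, h₂, Sum.map_inl, Sum.map_inr, id, Sum.inr.injEq, reduceCtorEq] at h
  · exact iff_of_true (hbT hz) (haT hy)
  · exact iff_of_true hv.1 hu.1
  · exact iff_of_false hv hu

variable {G : Type*} [Group G] [MulAction G Y]

/-- The permutation of the values that turns the valuation `a` of `Q` into the valuation `b` of
`g • Q`, preserving the set `T` and the numbering of the unused values in `T`. -/
noncomputable def permExt (g : G) (T : Set X) (Q : Set Y) (a b : Y → X) : Perm X :=
  relabel (label T Q a) (label T (g • Q) b) (Sum.map (g • ·) id)

variable {g : G} {b : Y → X}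

theorem label_permExt (ha : Set.InjOn a Q ∧ Set.MapsTo a Q T)
    (hb : Set.InjOn b (g • Q) ∧ Set.MapsTo b (g • Q) T) (u : X) :
    label T (g • Q) b (permExt g T Q a b u) = (label T Q a u).map (g • ·) id := by
  refine apply_relabel (label_injective ha.1 ha.2) (label_injective hb.1 hb.2)
    ((MulAction.injective g).sumMap Function.injective_id) ?_ u
  rw [range_label ha.1 ha.2, range_label hb.1 hb.2, Set.ncard_smul_set]
  simp only [Set.image_union, Set.image_image, Function.comp_apply, Sum.map_inl, Sum.map_inr, id]
  rw [← Set.image_smul, Set.image_image]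

theorem permExt_apply (ha : Set.InjOn a Q ∧ Set.MapsTo a Q T)
    (hb : Set.InjOn b (g • Q) ∧ Set.MapsTo b (g • Q) T) {y : Y} (hy : y ∈ Q) :
    permExt g T Q a b (a y) = b (g • y) := by
  apply label_injective hb.1 hb.2
  rw [label_permExt ha hb, label_apply ha.1 hy, label_apply hb.1 (Set.smul_mem_smul_set hy),
    Sum.map_inl]

theorem permExt_mem_iff (ha : Set.InjOn a Q ∧ Set.MapsTo a Q T)
    (hb : Set.InjOn b (g • Q) ∧ Set.MapsTo b (g • Q) T) (u : X) :
    permExt g T Q a b u ∈ T ↔ u ∈ T :=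
  mem_iff_of_label_eq ha.1 ha.2 hb.1 hb.2 (label_permExt ha hb u)

theorem permExt_mul {h : G} {c : Y → X} (ha : Set.InjOn a Q ∧ Set.MapsTo a Q T)
    (hb : Set.InjOn b (g • Q) ∧ Set.MapsTo b (g • Q) T)
    (hc : Set.InjOn c ((h * g) • Q) ∧ Set.MapsTo c ((h * g) • Q) T) :
    permExt (h * g) T Q a c = permExt h T (g • Q) b c * permExt g T Q a b := by
  ext u
  apply label_injective hc.1 hc.2
  rw [label_permExt ha hc]
  rw [mul_smul] at hc ⊢
  rw [Perm.mul_apply, label_permExt hb hc, label_permExt ha hb, Sum.map_map]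
  simp only [Function.comp_def, mul_smul]
  rfl

end Relabel

namespace Atlas

variable (S : Atlas A B)

/-- The sets of vertices that do not lie in a copy of `A`. -/
def nonBlocks : SubMulAction S.G (Set U) where
  carrier := {M | ∀ g, ¬ M ⊆ (S.block g).carrier}
  smul_mem' g M hM h hh := hM (g⁻¹ * h) fun x hx => by
    rw [← inv_smul_smul g x]
    exact smul_mem_block (hh (Set.smul_mem_smul_set hx))

/-- The values for the vertices in `M`; there are fewer than elements of `M`. -/
def cliqueVal (M : Set U) : Set (Fin (Nat.card U + 1)) := {u | u.1 + 1 < M.ncard}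

/-- Values of vertices in `M` are in `cliqueVal M` and different for different vertices. -/
def CliqueCompat (M : Set U) (y : U) (u : Fin (Nat.card U + 1)) (y' : U)
    (u' : Fin (Nat.card U + 1)) : Prop :=
  u ∈ cliqueVal M ∧ u' ∈ cliqueVal M ∧ (y ≠ y' → u ≠ u')

theorem compatOn_clique_iff {M Q : Set U} {a : U → Fin (Nat.card U + 1)} :
    CompatOn (CliqueCompat M) Q a ↔ Set.InjOn a Q ∧ Set.MapsTo a Q (cliqueVal M) := by
  refine ⟨fun h => ⟨fun y hy y' hy' => ?_, fun y hy => (h y hy y hy).1⟩,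
    fun h y hy y' hy' => ⟨h.2 hy, h.2 hy', h.1.ne hy hy'⟩⟩
  exact not_imp_not.1 (h y hy y' hy').2.2

theorem cliqueVal_smul (g : S.G) (M : Set U) : cliqueVal (g • M) = cliqueVal M := by
  rw [cliqueVal, cliqueVal, Set.ncard_smul_set]

variable [Finite U]

theorem ncard_cliqueVal (M : Set U) : (cliqueVal M).ncard = M.ncard - 1 := by
  have h : Fin.val '' cliqueVal M = Set.Iio (M.ncard - 1) := by
    ext n
    refine ⟨?_, fun hn => ?_⟩
    · rintro ⟨u, hu, rfl⟩
      exact Nat.lt_sub_of_add_lt hu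
    · have hn' := Nat.add_lt_of_lt_sub hn
      exact ⟨⟨n, by have := Set.ncard_le_card M; omega⟩, hn', rfl⟩
  rw [← Set.ncard_image_of_injective _ Fin.val_injective, h, Set.ncard_Iio_nat]

variable {S} in
theorem ncard_cliqueVal_lt {M : Set U} (hM : M ∈ S.nonBlocks) :
    (cliqueVal M).ncard < M.ncard := by
  have h : 0 < M.ncard := (Set.ncard_pos).2 <| Set.nonempty_iff_ne_empty.2 fun h =>
    hM 1 (h ▸ Set.empty_subset _)
  rw [ncard_cliqueVal]
  omega

theorem exists_cliqueStd (M : S.nonBlocks) :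
    ∃ a, CompatOn (CliqueCompat M.1) (Set.range S.ψ ∩ M) a := by
  have hlt : (Set.range S.ψ ∩ M.1).ncard < M.1.ncard := by
    refine Set.ncard_lt_ncard (Set.inter_subset_right.ssubset_of_not_subset fun h => M.2 1 ?_)
    refine fun x hx => (h hx).1.imp fun a ha => ?_
    exact (chart_one a).trans ha
  have hle : (Set.range S.ψ ∩ M.1).encard ≤ (cliqueVal M.1).encard := by
    rw [← Set.Finite.cast_ncard_eq (Set.toFinite _), ← Set.Finite.cast_ncard_eq (Set.toFinite _),
      ncard_cliqueVal]
    exact_mod_cast Nat.le_sub_one_of_lt hlt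
  obtain ⟨a, ha, ha'⟩ := Set.Finite.exists_injOn_of_encard_le (Set.toFinite _) hle
  exact ⟨a, compatOn_clique_iff.2 ⟨ha', ha⟩⟩

/-- The valuations of a set `M` outside the copies of `A` are injective with fewer values than
elements of `M`, so that a clique of the cover cannot project onto `M`. -/
noncomputable def cliqueSystem : LocalSystem S S.nonBlocks (Fin (Nat.card U + 1)) where
  supp M := M
  supp_smul _ _ := rfl
  Compat M := CliqueCompat M.1
  std M := (S.exists_cliqueStd M).choose
  std_compat M := (S.exists_cliqueStd M).choose_spec
  ext g M Q a b := permExt g (cliqueVal M.1) Q a b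
  ext_apply {g M Q a b} _ ha hb y hy := by
    rw [compatOn_clique_iff] at ha hb
    rw [SubMulAction.val_smul, cliqueVal_smul] at hb
    exact permExt_apply ha hb hy
  compat_ext_iff {g M Q a b} _ ha hb y u y' u' := by
    rw [compatOn_clique_iff] at ha hb
    rw [SubMulAction.val_smul, cliqueVal_smul] at hb
    rw [CliqueCompat, SubMulAction.val_smul, cliqueVal_smul, permExt_mem_iff ha hb,
      permExt_mem_iff ha hb, (MulAction.injective g).ne_iff, (Equiv.injective _).ne_iff]
    rfl
  ext_mul {g h M Q a b c} _ ha hb hc := by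
    rw [compatOn_clique_iff] at ha hb hc
    rw [SubMulAction.val_smul, cliqueVal_smul] at hb hc
    rw [permExt_mul ha hb hc, SubMulAction.val_smul, cliqueVal_smul]

theorem cliqueSystem_cover_conformal : S.cliqueSystem.cover.Conformal := by
  refine LocalSystem.cover_conformal fun C hC => ?_
  by_contra! h
  have hM : (fun v => v.1.1) '' C ∈ S.nonBlocks := by
    intro g hg
    obtain ⟨v, hv, hvg⟩ := h g
    exact hvg (hg ⟨v, hv, rfl⟩)
  obtain ⟨b, hb, -⟩ := LocalSystem.exists_valuation hC
  have hb := compatOn_clique_iff.1 (hb ⟨_, hM⟩)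
  refine (ncard_cliqueVal_lt hM).not_ge (Set.ncard_le_ncard_of_injOn _ (fun y hy => hb.2 ?_)
    (hb.1.mono fun y hy => ?_)) <;>
  · obtain ⟨v, hv, rfl⟩ := id hy
    exact ⟨Set.mem_biUnion hv (mem_cl_self _ _), hy⟩

end Atlas

/-! ### Potentials -/

namespace Atlas

/-- The edge from `x` to `s` is in no triangle of `M`. -/
structure EdgeInNoTriangle (S : Atlas A B) (M : Set U) (x s : U) : Prop where
  ne : x ≠ s
  eq_or_eq : ∀ z ∈ M, S.Adj x z → S.Adj s z → z = x ∨ z = s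

/-- The constraint on values of vertices that they differ along the edge from `x` to `s`, and agree
along all other edges. -/
def PotentialCompat (S : Atlas A B) (x s y : U) (k : ZMod 2) (y' : U) (k' : ZMod 2) : Prop :=
  S.Adj y y' → (k + k' = 1 ↔ s(x, s) = s(y, y'))

variable (S : Atlas A B)

/-- There is a potential on `M` whose coboundary is the edge from `x` to `s`; that is, every cycle
in `M` passes through this edge an even number of times. -/
def HasPotential (M : Set U) (x s : U) : Prop := ∃ k, CompatOn (S.PotentialCompat x s) M k

/-- Every cycle in a subset `M` of `C` passes an even number of times through each edge that is in
no triangle of `M`. -/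
def Untwisted (C : Set U) : Prop :=
  ∀ M ⊆ C, ∀ x s, S.EdgeInNoTriangle M x s → S.HasPotential M x s

variable {S}

theorem Untwisted.mono {C C' : Set U} (hC : S.Untwisted C) (h : C' ⊆ C) : S.Untwisted C' :=
  fun M hM => hC M (hM.trans h)

theorem adj_of_subset_range {Q : Set U} (hQ : Q ⊆ Set.range S.ψ) :
    ∀ y ∈ Q, ∀ y' ∈ Q, S.Adj y y' := by
  intro y hy y' hy'
  obtain ⟨a, rfl⟩ := hQ hy
  obtain ⟨b, rfl⟩ := hQ hy'
  exact ⟨1, ⟨a, chart_one a⟩, ⟨b, chart_one b⟩⟩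

theorem EdgeInNoTriangle.smul (g : S.G) {M : Set U} {x s : U} (h : S.EdgeInNoTriangle M x s) :
    S.EdgeInNoTriangle (g • M) (g • x) (g • s) := by
  refine ⟨(MulAction.injective g).ne h.ne, ?_⟩
  rintro _ ⟨z, hz, rfl⟩ hx hs
  exact (h.eq_or_eq z hz ((adj_smul_iff g).1 hx) ((adj_smul_iff g).1 hs)).imp
    (congrArg _) (congrArg _)

theorem potentialCompat_smul_iff (g : S.G) {x s y y' : U} {k k' c : ZMod 2} :
    S.PotentialCompat (g • x) (g • s) (g • y) (k + c) (g • y') (k' + c) ↔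
      S.PotentialCompat x s y k y' k' := by
  have hc : k + c + (k' + c) = k + k' := by
    rw [add_add_add_comm, CharTwo.add_self_eq_zero, add_zero]
  have hedge : s(g • x, g • s) = s(g • y, g • y') ↔ s(x, s) = s(y, y') :=
    (Sym2.map.injective (MulAction.injective g)).eq_iff (a := s(x, s)) (b := s(y, y'))
  rw [PotentialCompat, PotentialCompat, adj_smul_iff, hedge, hc]

/-- The edges in a set `M` that are in no triangle of `M`. -/
def bareEdges (S : Atlas A B) : SubMulAction S.G (Set U × U × U) where
  carrier := {i | S.EdgeInNoTriangle i.1 i.2.1 i.2.2}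
  smul_mem' g _ h := h.smul g

open Classical in
/-- A potential for the edge from `x` to `s` on the copy `ψ(A)`. -/
noncomputable def stdPotential (S : Atlas A B) (x s y : U) : ZMod 2 :=
  if s ∈ Set.range S.ψ ∧ y = x then 1 else 0

theorem compatOn_stdPotential {M : Set U} {x s : U} (h : S.EdgeInNoTriangle M x s) :
    CompatOn (S.PotentialCompat x s) (Set.range S.ψ ∩ M) (S.stdPotential x s) := by
  rintro y ⟨hy, hyM⟩ y' ⟨hy', hyM'⟩ -
  have hadj := adj_of_subset_range (S := S) subset_rfl
  have hs : s ∈ Set.range S.ψ → ∀ z ∈ Set.range S.ψ, z ∈ M → x ∈ Set.range S.ψ → z = x ∨ z = s :=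
    fun hs z hz hzM hx => h.eq_or_eq z hzM (hadj _ hx _ hz) (hadj _ hs _ hz)
  have hne := h.ne
  simp only [stdPotential, Sym2.eq_iff]
  split_ifs <;> grind

open Classical in
/-- The difference of the valuation `b` of `g • Q` and the valuation `a` of `Q`, if it is
constant. -/
noncomputable def shift (g : S.G) (Q : Set U) (a b : U → ZMod 2) : ZMod 2 :=
  if h : Q.Nonempty then b (g • h.some) - a h.some else 0

theorem shift_eq {g : S.G} {Q : Set U} {x s : U} {a b : U → ZMod 2}
    (hQ : ∀ y ∈ Q, ∀ y' ∈ Q, S.Adj y y') (ha : CompatOn (S.PotentialCompat x s) Q a)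
    (hb : CompatOn (S.PotentialCompat (g • x) (g • s)) (g • Q) b) {y : U} (hy : y ∈ Q) :
    shift g Q a b = b (g • y) - a y := by
  have hsome := (Set.nonempty_of_mem hy).some_mem
  have hadj := hQ _ hy _ hsome
  have ha := ha _ hy _ hsome hadj
  have hb := (potentialCompat_smul_iff (c := 0) g).1 (by
    simpa only [add_zero] using
      hb _ (Set.smul_mem_smul_set hy) _ (Set.smul_mem_smul_set hsome)) hadj
  have two_values : ∀ p q r t : ZMod 2, (p + q = 1 ↔ r + t = 1) → t - q = r - p := by decide
  rw [shift, dif_pos ⟨y, hy⟩]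
  exact two_values _ _ _ _ (ha.trans hb.symm)

theorem shift_mul {g h : S.G} {Q : Set U} {x s : U} {a b c : U → ZMod 2}
    (hQ : ∀ y ∈ Q, ∀ y' ∈ Q, S.Adj y y') (ha : CompatOn (S.PotentialCompat x s) Q a)
    (hb : CompatOn (S.PotentialCompat (g • x) (g • s)) (g • Q) b)
    (hc : CompatOn (S.PotentialCompat ((h * g) • x) ((h * g) • s)) ((h * g) • Q) c) :
    shift (h * g) Q a c = shift g Q a b + shift h (g • Q) b c := by
  obtain rfl | ⟨y, hy⟩ := Q.eq_empty_or_nonempty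
  · simp [shift]
  · have hgQ : ∀ z ∈ g • Q, ∀ z' ∈ g • Q, S.Adj z z' := by
      rintro _ ⟨z, hz, rfl⟩ _ ⟨z', hz', rfl⟩
      exact (hQ z hz z' hz').smul g
    have hc' := hc
    rw [mul_smul, mul_smul, mul_smul] at hc'
    rw [shift_eq hQ ha hc hy, shift_eq hQ ha hb hy,
      shift_eq hgQ hb hc' (Set.smul_mem_smul_set hy), mul_smul]
    abel

/-- Every edge in no triangle of a set `M` obtains a potential on `M`, so that the edge is doubled
in the cover if it lies on a cycle of `M`. -/
noncomputable def twistSystem (S : Atlas A B) : LocalSystem S S.bareEdges (ZMod 2) where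
  supp i := i.1.1
  supp_smul _ _ := rfl
  Compat i := S.PotentialCompat i.1.2.1 i.1.2.2
  std i := S.stdPotential i.1.2.1 i.1.2.2
  std_compat i := compatOn_stdPotential i.2
  ext g _ Q a b := Equiv.addRight (shift g Q a b)
  ext_apply {g i Q a b} hQ ha hb y hy := by
    rw [shift_eq (adj_of_subset_range hQ) ha hb hy]
    exact add_sub_cancel _ _
  compat_ext_iff _ _ _ _ _ _ _ := potentialCompat_smul_iff _
  ext_mul {g h i Q a b c} hQ ha hb hc := by
    ext u
    rw [shift_mul (adj_of_subset_range hQ) ha hb hc]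
    exact (add_assoc u _ _).symm

theorem Conformal.twistSystem_cover (hS : S.Conformal) : S.twistSystem.cover.Conformal := by
  refine LocalSystem.cover_conformal fun C hC => ?_
  obtain ⟨g, hg⟩ := hS ((fun v => v.1.1) '' C) (by
    rintro _ ⟨v, hv, rfl⟩ _ ⟨w, hw, rfl⟩
    exact LocalSystem.adj_of_cover_adj (hC v hv w hw))
  exact ⟨g, fun v hv => hg ⟨v, hv, rfl⟩⟩

theorem untwisted_image {C : Set S.twistSystem.CoverVertex}
    (hC : ∀ v ∈ C, ∀ w ∈ C, S.Adj v.1.1 w.1.1 → S.twistSystem.cover.Adj v w) :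
    S.Untwisted ((fun v => v.1.1) '' C) := by
  intro M hM x s h
  have hval (y : U) :
      ∃ k, y ∈ M → ∃ v ∈ C, v.1.1 = y ∧ (y, ⟨(M, x, s), h⟩, k) ∈ v.1.2 := by
    by_cases hy : y ∈ M
    · obtain ⟨v, hv, rfl⟩ := hM hy
      obtain ⟨k, hk⟩ :=
        LocalSystem.exists_mem_snd (i := ⟨(M, x, s), h⟩) v ⟨mem_cl_self _ _, hy⟩
      exact ⟨k, fun _ => ⟨v, hv, rfl, hk⟩⟩
    · exact ⟨0, fun hy' => (hy hy').elim⟩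
  choose k hk using hval
  refine ⟨k, fun y hy y' hy' hadj => ?_⟩
  obtain ⟨v, hv, rfl, hvk⟩ := hk y hy
  obtain ⟨w, hw, rfl, hwk⟩ := hk y' hy'
  exact (LocalSystem.dec_of_adj (hC v hv w hw hadj) hvk hwk).1 hadj

end Atlas

/-! ### Free amalgamation -/

section FreeAmalgam

variable {X Y W₁ W₂ : Type*} {D : GStr L X} {B₁ : GStr L W₁} {B₂ : GStr L W₂}

theorem Emb.mem_rel_iff_of_lang_eq {e₁ : Emb D B₁} {e₂ : Emb D B₂} (h : e₁.lang = e₂.lang) {k : ℕ}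
    {R : L.Rel k} {d : Fin (k + 1) → X} :
    (fun i => e₁ (d i)) ∈ B₁.rel R ↔ (fun i => e₂ (d i)) ∈ B₂.rel R := by
  rw [← onRel_onRel_inv e₁.lang R, e₁.mem_rel_iff, h, e₂.mem_rel_iff]

/-- A pushout square of injective maps. -/
structure IsGluing (e₁ : Emb D B₁) (e₂ : Emb D B₂) (b₁ : W₁ → Y) (b₂ : W₂ → Y) : Prop where
  injective_left : Function.Injective b₁
  injective_right : Function.Injective b₂
  comm : ∀ d, b₁ (e₁ d) = b₂ (e₂ d)
  exists_eq : ∀ x y, b₁ x = b₂ y → ∃ d, x = e₁ d ∧ y = e₂ d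
  cover : Set.range b₁ ∪ Set.range b₂ = Set.univ

theorem IsGluing.symm {e₁ : Emb D B₁} {e₂ : Emb D B₂} {b₁ : W₁ → Y} {b₂ : W₂ → Y}
    (h : IsGluing e₁ e₂ b₁ b₂) : IsGluing e₂ e₁ b₂ b₁ where
  injective_left := h.injective_right
  injective_right := h.injective_left
  comm d := (h.comm d).symm
  exists_eq x y hxy := (h.exists_eq y x hxy.symm).imp fun _ => And.symm
  cover := (Set.union_comm _ _).trans h.cover

open Classical in
theorem exists_isGluing {X : Type w₁} {W₁ W₂ : Type w} {D : GStr L X} {B₁ : GStr L W₁}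
    {B₂ : GStr L W₂} (e₁ : Emb D B₁) (e₂ : Emb D B₂) :
    ∃ (Y : Type w) (b₁ : W₁ → Y) (b₂ : W₂ → Y), IsGluing e₁ e₂ b₁ b₂ := by
  refine ⟨W₁ ⊕ {y // y ∉ Set.range e₂}, Sum.inl,
    fun y => if h : y ∈ Set.range e₂ then .inl (e₁ h.choose) else .inr ⟨y, h⟩,
    Sum.inl_injective, fun y y' hy => ?_, fun d => ?_, fun x y hy => ?_, ?_⟩
  · by_cases h : y ∈ Set.range e₂ <;> by_cases h' : y' ∈ Set.range e₂ <;>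
      simp only [h, h', dif_pos, dif_neg, not_false_eq_true, reduceCtorEq, Sum.inl.injEq,
        Sum.inr.injEq, Subtype.mk.injEq] at hy
    · rw [← h.choose_spec, ← h'.choose_spec, e₁.injective hy]
    · exact hy
  · have h : e₂ d ∈ Set.range e₂ := ⟨d, rfl⟩
    simp only [h, dif_pos]
    rw [e₂.injective h.choose_spec]
  · by_cases h : y ∈ Set.range e₂ <;>
      simp only [h, dif_pos, dif_neg, not_false_eq_true, reduceCtorEq, Sum.inl.injEq] at hy
    exact ⟨h.choose, hy, h.choose_spec.symm⟩
  · refine Set.eq_univ_of_forall fun z => ?_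
    obtain x | ⟨y, hy⟩ := z
    · exact .inl ⟨x, rfl⟩
    · exact .inr ⟨y, dif_neg hy⟩

/-- The union of the images of `B₁` and `B₂` under `b₁` and `b₂`. -/
def glue (B₁ : GStr L W₁) (B₂ : GStr L W₂) (b₁ : W₁ → Y) (b₂ : W₂ → Y) : GStr L Y where
  rel R := (b₁ ∘ ·) '' B₁.rel R ∪ (b₂ ∘ ·) '' B₂.rel R
  fn F z := (⋃ x ∈ b₁ ⁻¹' {z}, b₁ '' B₁.fn F x) ∪ ⋃ y ∈ b₂ ⁻¹' {z}, b₂ '' B₂.fn F y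

variable {e₁ : Emb D B₁} {e₂ : Emb D B₂} {b₁ : W₁ → Y} {b₂ : W₂ → Y}

theorem glue_comm : glue B₁ B₂ b₁ b₂ = glue B₂ B₁ b₂ b₁ := by
  simp only [glue, Set.union_comm]

namespace IsGluing

theorem mem_glue_rel_iff (h : IsGluing e₁ e₂ b₁ b₂) (hlang : e₁.lang = e₂.lang) {k : ℕ}
    {R : L.Rel k} {x : Fin (k + 1) → W₁} :
    (fun i => b₁ (x i)) ∈ (glue B₁ B₂ b₁ b₂).rel R ↔ x ∈ B₁.rel R := by
  refine ⟨?_, fun hx => .inl ⟨x, hx, rfl⟩⟩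
  rintro (⟨x', hx', hxx'⟩ | ⟨y, hy, hxy⟩)
  · rwa [← h.injective_left.comp_left hxx']
  · choose d hx hd using fun i => h.exists_eq (x i) (y i) (congrFun hxy i).symm
    obtain rfl : x = fun i => e₁ (d i) := funext hx
    obtain rfl : y = fun i => e₂ (d i) := funext hd
    exact (Emb.mem_rel_iff_of_lang_eq hlang).2 hy

theorem glue_fn (h : IsGluing e₁ e₂ b₁ b₂) (hlang : e₁.lang = e₂.lang) (F : L.Fn) (x : W₁) :
    b₁ '' B₁.fn F x = (glue B₁ B₂ b₁ b₂).fn F (b₁ x) := by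
  refine Set.Subset.antisymm (fun z hz => .inl (Set.mem_biUnion rfl hz))
    (Set.union_subset (Set.iUnion₂_subset fun x' hx' => ?_) (Set.iUnion₂_subset fun y hy => ?_))
  · rw [h.injective_left hx']
  · obtain ⟨d, rfl, rfl⟩ := h.exists_eq x y (Eq.symm hy)
    rw [← onFn_onFn_inv e₂.lang F, ← e₂.image_fn, ← hlang, ← e₁.image_fn, Set.image_image,
      Set.image_image]
    simp only [h.comm, subset_rfl]

/-- The embedding of the left-hand structure in the union. -/
def emb (h : IsGluing e₁ e₂ b₁ b₂) (hlang : e₁.lang = e₂.lang) :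
    Emb B₁ (glue B₁ B₂ b₁ b₂) :=
  .ofEq 1 b₁ h.injective_left (fun _ _ => (h.mem_glue_rel_iff hlang).symm) (h.glue_fn hlang)

theorem isFreeAmalgam (h : IsGluing e₁ e₂ b₁ b₂) (hlang : e₁.lang = e₂.lang)
    (β₂ : Emb B₂ (glue B₁ B₂ b₁ b₂)) (hβ₂ : β₂.lang = 1) (hb₂ : ∀ y, β₂ y = b₂ y) :
    IsFreeAmalgam e₁ e₂ (h.emb hlang) β₂ := by
  have hb₂ : β₂.toFun = b₂ := funext hb₂
  refine ⟨Emb.ext' ?_ fun d => ?_, fun x y hxy => ?_, ?_, ?_⟩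
  · rw [Emb.comp_lang, Emb.comp_lang, hβ₂, hlang]
    rfl
  · exact (h.comm d).trans (congrFun hb₂ _).symm
  · obtain ⟨d, rfl, rfl⟩ := h.exists_eq x y (hxy.trans (congrFun hb₂ y))
    exact ⟨⟨d, rfl⟩, ⟨d, rfl⟩⟩
  · rw [hb₂]
    exact h.cover
  · rw [hb₂]
    rintro k R _ ⟨i, x, hx, hi⟩ ⟨j, y, hy, hj⟩ (⟨z, -, rfl⟩ | ⟨z, -, rfl⟩)
    · obtain ⟨d, -, rfl⟩ := h.exists_eq _ _ hj.symm
      exact hy ⟨d, rfl⟩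
    · obtain ⟨d, rfl, -⟩ := h.exists_eq _ _ hi
      exact hx ⟨d, rfl⟩

end IsGluing

theorem exists_isFreeAmalgam {X : Type w₁} {W₁ W₂ : Type w} {D : GStr L X} {B₁ : GStr L W₁}
    {B₂ : GStr L W₂} (e₁ : Emb D B₁) (e₂ : Emb D B₂) (hlang : e₁.lang = e₂.lang) :
    ∃ (Y : Type w) (C : GStr L Y) (β₁ : Emb B₁ C) (β₂ : Emb B₂ C),
      IsFreeAmalgam e₁ e₂ β₁ β₂ ∧ β₁.lang = 1 ∧ β₂.lang = 1 := by
  obtain ⟨Y, b₁, b₂, h⟩ := exists_isGluing e₁ e₂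
  obtain ⟨β₂, hβ₂, hb₂⟩ : ∃ β₂ : Emb B₂ (glue B₁ B₂ b₁ b₂), β₂.lang = 1 ∧ ∀ y, β₂ y = b₂ y := by
    rw [glue_comm]
    exact ⟨h.symm.emb hlang.symm, rfl, fun _ => rfl⟩
  exact ⟨Y, _, h.emb hlang, β₂, h.isFreeAmalgam hlang β₂ hβ₂ hb₂, rfl, hβ₂⟩

end FreeAmalgam

/-! ### Separation along cliques -/

namespace Atlas

variable {S : Atlas A B}

/-- The substructures `C₁` and `C₂` overlap in a clique, and no vertex outside `C₂` is adjacent to a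
vertex outside `C₁`. -/
structure CliqueSeparation (S : Atlas A B) (C C₁ C₂ : Substr B) : Prop where
  union : C₁.carrier ∪ C₂.carrier = C.carrier
  clique : ∀ s ∈ C₁.carrier ∩ C₂.carrier, ∀ t ∈ C₁.carrier ∩ C₂.carrier, S.Adj s t
  not_adj : ∀ a ∈ C₁.carrier \ C₂.carrier, ∀ b ∈ C₂.carrier \ C₁.carrier, ¬S.Adj a b

/-- The vertices in the component of `y` in `C` without the neighbours of `x`. -/
def component (S : Atlas A B) (C : Set U) (x y : U) : Set U :=
  {z | Relation.ReflTransGen (fun a b => b ∈ C ∧ ¬S.Adj x b ∧ S.Adj a b) y z}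

/-- The neighbours of `x` in `C` that are adjacent to the component of `y`. -/
def componentBoundary (S : Atlas A B) (C : Set U) (x y : U) : Set U :=
  {z ∈ C | S.Adj x z ∧ ∃ k ∈ S.component C x y, S.Adj k z}

section Component

variable {C : Set U} {x y z z' s t : U}

theorem mem_of_mem_component (hy : y ∈ C) (hz : z ∈ S.component C x y) : z ∈ C := by
  obtain rfl | ⟨_, -, h⟩ := hz.cases_tail
  exacts [hy, h.1]

theorem not_adj_of_mem_component (hxy : ¬S.Adj x y) (hz : z ∈ S.component C x y) :
    ¬S.Adj x z := by
  obtain rfl | ⟨_, -, h⟩ := hz.cases_tail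
  exacts [hxy, h.2.1]

theorem mem_component_of_adj (hz : z ∈ S.component C x y) (hz' : z' ∈ C) (hxz : ¬S.Adj x z')
    (h : S.Adj z z') : z' ∈ S.component C x y := hz.tail ⟨hz', hxz, h⟩

theorem mem_component_or_boundary (hz : z ∈ S.component C x y) (hz' : z' ∈ C) (h : S.Adj z z') :
    z' ∈ S.component C x y ∪ S.componentBoundary C x y := by
  by_cases hx : S.Adj x z'
  · exact .inr ⟨hz', hx, z, hz, h⟩
  · exact .inl (mem_component_of_adj hz hz' hx h)

theorem eq_of_mem_component {M : Set U} {k : U → ZMod 2}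
    (hk : CompatOn (S.PotentialCompat x s) M k) (hM : S.component C x y ⊆ M)
    (hx : x ∉ S.component C x y) (hz : z ∈ S.component C x y) (hz' : z' ∈ M)
    (hadj : S.Adj z z') (hxz' : x ≠ z') : k z = k z' := by
  have hne : s(x, s) ≠ s(z, z') := fun h => by
    have hmem : x ∈ s(z, z') := h ▸ Sym2.mem_mk_left x s
    obtain rfl | rfl := Sym2.mem_iff.1 hmem
    exacts [hx hz, hxz' rfl]
  have eq_of_add_ne_one : ∀ p q : ZMod 2, p + q ≠ 1 → p = q := by decide
  exact eq_of_add_ne_one _ _ fun h => hne ((hk z (hM hz) z' hz' hadj).1 h)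

/-- If `s` and `t` were not adjacent, the edge from `x` to `s` would be in no triangle of the
component together with `x`, `s` and `t`, but on a cycle through `t`. -/
theorem adj_of_mem_componentBoundary (hS : S.Covered) (hC : S.Untwisted C) (hx : x ∈ C)
    (hy : y ∈ C) (hxy : ¬S.Adj x y) (hs : s ∈ S.componentBoundary C x y)
    (ht : t ∈ S.componentBoundary C x y) : S.Adj s t := by
  by_contra hst
  obtain ⟨hsC, hxs, p, hp, hps⟩ := hs
  obtain ⟨htC, hxt, q, hq, hqt⟩ := ht
  have hxK : x ∉ S.component C x y := fun h => not_adj_of_mem_component hxy h (hS.adj_self x)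
  have hxs_ne : x ≠ s := fun h => not_adj_of_mem_component hxy hp (h ▸ hps.symm)
  have hxt_ne : x ≠ t := fun h => not_adj_of_mem_component hxy hq (h ▸ hqt.symm)
  have hst_ne : s ≠ t := fun h => hst (h ▸ hS.adj_self s)
  obtain ⟨k, hk⟩ := hC (insert x (insert s (insert t (S.component C x y))))
    (Set.insert_subset hx <| Set.insert_subset hsC <| Set.insert_subset htC fun _ =>
      mem_of_mem_component hy) x s
    ⟨hxs_ne, by
      rintro z (rfl | rfl | rfl | hz) hxz hsz
      exacts [.inl rfl, .inr rfl, (hst hsz).elim, (not_adj_of_mem_component hxy hz hxz).elim]⟩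
  have hKM : S.component C x y ⊆ insert x (insert s (insert t (S.component C x y))) :=
    fun z hz => .inr <| .inr <| .inr hz
  have hK {z : U} (hz : z ∈ S.component C x y) : k y = k z := by
    induction hz with
    | refl => rfl
    | tail hz h ih =>
      refine ih.trans (eq_of_mem_component hk hKM hxK hz (hKM (hz.tail h)) h.2.2 fun h' => ?_)
      exact h.2.1 (h' ▸ hS.adj_self x)
  have hks : k p = k s := eq_of_mem_component hk hKM hxK hp (.inr <| .inl rfl) hps hxs_ne
  have hkt : k q = k t := eq_of_mem_component hk hKM hxK hq (.inr <| .inr <| .inl rfl) hqt hxt_ne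
  have hxs_one : k x + k s = 1 := (hk x (.inl rfl) s (.inr <| .inl rfl) hxs).2 rfl
  have hxt_one : k x + k t = 1 := by rw [← hkt, ← hK hq, hK hp, hks, hxs_one]
  have hedge := (hk x (.inl rfl) t (.inr <| .inr <| .inl rfl) hxt).1 hxt_one
  exact hst_ne (Sym2.congr_right.1 hedge)

end Component

/-- The component of `y` with its boundary. -/
def componentSide (hS : S.Covered) (C : Substr B) (x : U) {y : U} (hy : y ∈ C.carrier) :
    Substr B where
  carrier := S.component C.carrier x y ∪ S.componentBoundary C.carrier x y
  closed F z hz z' hz' := by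
    have hadj : S.Adj z z' := (hS.adj_self z).cl_right (fn_subset_cl F z hz')
    obtain hz | ⟨hzC, hxz, k, hk, hkz⟩ := hz
    · exact mem_component_or_boundary hz (C.closed F z (mem_of_mem_component hy hz) hz') hadj
    · have hz' := fn_subset_cl F z hz'
      exact .inr ⟨C.cl_subset hzC hz', hxz.cl_right hz', k, hk, hkz.cl_right hz'⟩

/-- The complement of the component of `y`. -/
def componentCompl (hS : S.Covered) (C : Substr B) {x y : U} (hxy : ¬S.Adj x y) : Substr B where
  carrier := C.carrier \ S.component C.carrier x y
  closed F z hz z' hz' := by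
    have hcl := fn_subset_cl F z hz'
    refine ⟨C.closed F z hz.1 hz', fun hmem => hz.2 ?_⟩
    refine mem_component_of_adj hmem hz.1 (fun hxz => ?_) ((hS.adj_self z).cl_right hcl).symm
    exact not_adj_of_mem_component hxy hmem (hxz.cl_right hcl)

theorem exists_cliqueSeparation (hS : S.Covered) {C : Substr B} (hC : S.Untwisted C.carrier)
    {x y : U} (hx : x ∈ C.carrier) (hy : y ∈ C.carrier) (hxy : ¬S.Adj x y) :
    ∃ C₁ C₂ : Substr B, S.CliqueSeparation C C₁ C₂ ∧
      C₁.carrier ⊂ C.carrier ∧ C₂.carrier ⊂ C.carrier := by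
  have hxK : x ∉ S.component C.carrier x y :=
    fun h => not_adj_of_mem_component hxy h (hS.adj_self x)
  have hxN : x ∉ S.componentBoundary C.carrier x y := by
    rintro ⟨-, -, k, hk, hkx⟩
    exact not_adj_of_mem_component hxy hk hkx.symm
  have hKC : S.component C.carrier x y ⊆ C.carrier := fun _ => mem_of_mem_component hy
  have hNC : S.componentBoundary C.carrier x y ⊆ C.carrier := Set.sep_subset _ _
  have hsub : (componentSide hS C x hy).carrier ⊆ C.carrier := Set.union_subset hKC hNC
  have hinter : (componentSide hS C x hy).carrier ∩ (componentCompl hS C hxy).carrier ⊆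
      S.componentBoundary C.carrier x y :=
    fun z hz => hz.1.resolve_left hz.2.2
  refine ⟨componentSide hS C x hy, componentCompl hS C hxy, ⟨?_, ?_, ?_⟩, ?_, ?_⟩
  · refine Set.Subset.antisymm (Set.union_subset hsub Set.sdiff_subset) fun z hz => ?_
    by_cases hzK : z ∈ S.component C.carrier x y
    exacts [.inl (.inl hzK), .inr ⟨hz, hzK⟩]
  · exact fun s hs t ht =>
      adj_of_mem_componentBoundary hS hC hx hy hxy (hinter hs) (hinter ht)
  · rintro a ⟨ha, ha'⟩ b ⟨hb, hb'⟩ hab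
    have haK : a ∈ S.component C.carrier x y := by
      by_contra h
      exact ha' ⟨hsub ha, h⟩
    exact hb' (mem_component_or_boundary haK hb.1 hab)
  · exact Set.ssubset_iff_exists.2 ⟨hsub, x, hx, fun h => h.elim hxK hxN⟩
  · exact Set.ssubset_iff_exists.2 ⟨Set.sdiff_subset, y, hy, fun h => h.2 .refl⟩

end Atlas

section

variable {V W : Type*} {A : GStr L V} {B : GStr L W}

/-- The preimage of a substructure under an embedding. -/
def Emb.comap (e : Emb A B) (C : Substr B) : Substr A where
  carrier := e ⁻¹' C.carrier
  closed F a ha _ hb := C.closed _ _ ha (e.map_fn F a ⟨_, hb, rfl⟩)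

/-- The structure `A` with the symbols permuted by `g`. -/
def permuteSymbols (A : GStr L V) (g : L.Γ) : GStr L V where
  rel R := A.rel (PermLang.onRel g⁻¹ R)
  fn F := A.fn (PermLang.onFn g⁻¹ F)

/-- The isomorphism from `A` to `A` with the symbols permuted. -/
def permuteSymbolsEmb (A : GStr L V) (g : L.Γ) : Emb A (A.permuteSymbols g) :=
  .ofEq g id Function.injective_id (fun R x => by simp [permuteSymbols])
    (fun F x => by simp [permuteSymbols])

end

theorem isTreeAmalgam_permuteSymbols (A : GStr L V) (g : L.Γ) :
    IsTreeAmalgam A (A.permuteSymbols g) :=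
  .copy (A.permuteSymbolsEmb g).toHom
    { (A.permuteSymbolsEmb g).isEmbedding with surjective := Function.surjective_id }

namespace Atlas

variable {S : Atlas A B} {Z : Type*}

/-- On every part of a copy of `A` that is a substructure inside `C`, the map `f` is an embedding in
`D`, with the identity as its language part, that factors through an embedding of `A`. -/
def FactorsOnBlocks (S : Atlas A B) (C : Set U) (D : GStr L Z) (f : U → Z) : Prop :=
  ∀ g, ∀ K : Substr A, S.chart g '' K.carrier ⊆ C → ∃ (j : Emb K.str A) (α : Emb A D),
    α.lang * j.lang = (S.chart g).lang ∧ ∀ a : K.carrier, α (j a) = f (S.chart g a)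

namespace FactorsOnBlocks

variable {C : Set U} {D : GStr L Z} {f : U → Z} {Y : Type*} {E : GStr L Y}

theorem comp {X : Type*} {D' : GStr L X} (hf : S.FactorsOnBlocks C D f) (β : Emb D D')
    (hβ : β.lang = 1) : S.FactorsOnBlocks C D' (β ∘ f) := by
  intro g K hK
  obtain ⟨j, α, hlang, hα⟩ := hf g K hK
  exact ⟨j, β.comp α, by rw [Emb.comp_lang, hβ, one_mul, hlang], fun a => congrArg β (hα a)⟩

theorem exists_emb (hf : S.FactorsOnBlocks C D f) (e : Emb E B) (he : ∀ y, e y ∈ C) {g : S.G}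
    (hg : ∀ y, e y ∈ (S.block g).carrier) :
    ∃ e' : Emb E D, e'.lang = e.lang ∧ ∀ y, e' y = f (e y) := by
  let K := (S.chart g).comap e.range
  have hK : S.chart g '' K.carrier ⊆ C := by
    rintro _ ⟨a, ⟨y, hy⟩, rfl⟩
    exact Set.mem_of_eq_of_mem hy.symm (he y)
  have hi (y : Y) : e y ∈ Set.range ((S.chart g).comp K.incl) := by
    obtain ⟨a, ha⟩ := hg y
    exact ⟨⟨a, y, ha.symm⟩, ha⟩
  obtain ⟨j, α, hlang, hα⟩ := hf g K hK
  refine ⟨(α.comp j).comp (((S.chart g).comp K.incl).lift e hi), ?_, fun y => ?_⟩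
  · simp [hlang]
  · exact (hα _).trans (congrArg f (Emb.apply_lift _ e hi y))

theorem exists_emb_comap (hf : S.FactorsOnBlocks C D f) (e : Emb E B) (he : ∀ y, e y ∈ C)
    (g : S.G) :
    ∃ e' : Emb (e.comap (S.block g)).str D, e'.lang = e.lang ∧ ∀ y, e' y = f (e y) :=
  hf.exists_emb (e.comp (e.comap (S.block g)).incl) (fun y => he y) (fun y => y.2)

/-- The homomorphism from a structure embedded in `C` to `D` given by `f`. -/
def hom (hf : S.FactorsOnBlocks C D f) (hS : S.Covered) (e : Emb E B) (he : ∀ y, e y ∈ C) :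
    Hom E D where
  lang := e.lang
  toFun y := f (e y)
  map_rel R x hx := by
    obtain ⟨g, hg⟩ := hS.rel _ _ (e.map_rel R x hx)
    obtain ⟨e', hlang, he'⟩ := hf.exists_emb_comap e he g
    have h := e'.map_rel R (fun i => ⟨x i, hg i⟩) hx
    rw [hlang] at h
    simpa only [he'] using h
  map_fn := by
    rintro F x _ ⟨y, hy, rfl⟩
    obtain ⟨g, hg⟩ := hS.vertex (e x)
    obtain ⟨e', hlang, he'⟩ := hf.exists_emb_comap e he g
    have h := e'.map_fn F ⟨x, hg⟩ ⟨⟨y, (e.comap (S.block g)).closed F x hg hy⟩, hy, rfl⟩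
    rw [hlang] at h
    simpa only [he'] using h

theorem hom_isHomEmbedding (hf : S.FactorsOnBlocks C D f) (hS : S.Covered) (hS' : S.Conformal)
    (e : Emb E B) (he : ∀ y, e y ∈ C) : (hf.hom hS e he).IsHomEmbedding := by
  intro P hP
  obtain ⟨g, hg⟩ := hS.range_subset_block hS' hP (e.comp P.incl)
  obtain ⟨e', hlang, he'⟩ := hf.exists_emb (e.comp P.incl) (fun p => he p) fun p => hg ⟨p, rfl⟩
  rw [show (hf.hom hS e he).comp P.incl.toHom = e'.toHom from
    Hom.ext' hlang.symm fun p => (he' p).symm]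
  exact e'.isEmbedding

end FactorsOnBlocks

/-- There is a map of `C` to a tree amalgamation of copies of `A` that factors on the copies of
`A`. -/
def HasTreeMap {V : Type w} {A : GStr L V} (S : Atlas A B) (C : Set U) : Prop :=
  ∃ (Z : Type w) (D : GStr L Z) (f : U → Z), IsTreeAmalgam A D ∧ S.FactorsOnBlocks C D f

theorem hasTreeMap_of_subset_block (hS : S.Covered) {C : Set U} {g : S.G}
    (hC : C ⊆ (S.block g).carrier) : S.HasTreeMap C := by
  have hinv (x : U) : ∃ a, ∀ b, S.chart g b = x → b = a := by
    by_cases hx : ∃ a, S.chart g a = x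
    · obtain ⟨a, rfl⟩ := hx
      exact ⟨a, fun b hb => (S.chart g).injective hb⟩
    · obtain ⟨-, a, -⟩ := hS.vertex x
      exact ⟨a, fun b hb => (hx ⟨b, hb⟩).elim⟩
  choose f hf using hinv
  refine ⟨V, _, f, isTreeAmalgam_permuteSymbols A (S.chart g).lang, fun h K hK => ?_⟩
  have hKg (a : K.carrier) : (S.chart h).comp K.incl a ∈ Set.range (S.chart g) :=
    hC (hK ⟨a, a.2, rfl⟩)
  refine ⟨(S.chart g).lift ((S.chart h).comp K.incl) hKg, A.permuteSymbolsEmb _, ?_, fun a => ?_⟩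
  · exact (mul_inv_cancel_left _ _).trans (mul_one _)
  · exact hf _ _ ((S.chart g).apply_lift _ hKg a)

namespace CliqueSeparation

variable {C C₁ C₂ : Substr B}

theorem subset_or_subset (h : S.CliqueSeparation C C₁ C₂) {Q : Set U} (hQ : Q ⊆ C.carrier)
    (hadj : ∀ x ∈ Q, ∀ y ∈ Q, S.Adj x y) : Q ⊆ C₁.carrier ∨ Q ⊆ C₂.carrier := by
  by_contra! hne
  obtain ⟨⟨b, hb, hb₁⟩, ⟨a, ha, ha₂⟩⟩ := hne.imp Set.not_subset.1 Set.not_subset.1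
  rw [← h.union] at hQ
  exact h.not_adj a ⟨(hQ ha).resolve_right ha₂, ha₂⟩ b ⟨(hQ hb).resolve_left hb₁, hb₁⟩
    (hadj a ha b hb)

theorem factorsOnBlocks_piecewise [DecidablePred (· ∈ C₁.carrier)]
    (h : S.CliqueSeparation C C₁ C₂) {D : GStr L Z} {f₁ f₂ : U → Z}
    (hf₁ : S.FactorsOnBlocks C₁.carrier D f₁) (hf₂ : S.FactorsOnBlocks C₂.carrier D f₂)
    (heq : ∀ x ∈ C₁.carrier ∩ C₂.carrier, f₁ x = f₂ x) :
    S.FactorsOnBlocks C.carrier D (C₁.carrier.piecewise f₁ f₂) := by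
  intro g K hK
  have hadj : ∀ x ∈ S.chart g '' K.carrier, ∀ y ∈ S.chart g '' K.carrier, S.Adj x y := by
    rintro _ ⟨a, -, rfl⟩ _ ⟨b, -, rfl⟩
    exact ⟨g, ⟨a, rfl⟩, ⟨b, rfl⟩⟩
  obtain hK₁ | hK₂ := h.subset_or_subset hK hadj
  · obtain ⟨j, α, hlang, hα⟩ := hf₁ g K hK₁
    refine ⟨j, α, hlang, fun a => (hα a).trans ?_⟩
    exact (Set.piecewise_eq_of_mem _ _ _ (hK₁ ⟨a, a.2, rfl⟩)).symm
  · obtain ⟨j, α, hlang, hα⟩ := hf₂ g K hK₂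
    refine ⟨j, α, hlang, fun a => (hα a).trans ?_⟩
    by_cases ha : S.chart g a ∈ C₁.carrier
    · rw [Set.piecewise_eq_of_mem _ _ _ ha, heq _ ⟨ha, hK₂ ⟨a, a.2, rfl⟩⟩]
    · rw [Set.piecewise_eq_of_notMem _ _ _ ha]

theorem hasTreeMap (h : S.CliqueSeparation C C₁ C₂) (hS : S.Conformal)
    (h₁ : S.HasTreeMap C₁.carrier) (h₂ : S.HasTreeMap C₂.carrier) : S.HasTreeMap C.carrier := by
  classical
  obtain ⟨Z₁, D₁, f₁, hD₁, hf₁⟩ := h₁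
  obtain ⟨Z₂, D₂, f₂, hD₂, hf₂⟩ := h₂
  obtain ⟨g, hg⟩ := hS _ h.clique
  let K := (S.chart g).comap (C₁.inter C₂)
  have hK : S.chart g '' K.carrier ⊆ C₁.carrier ∩ C₂.carrier := Set.image_preimage_subset _ _
  obtain ⟨j₁, α₁, hlang₁, hα₁⟩ := hf₁ g K (hK.trans Set.inter_subset_left)
  obtain ⟨j₂, α₂, hlang₂, hα₂⟩ := hf₂ g K (hK.trans Set.inter_subset_right)
  obtain ⟨Z, D, β₁, β₂, hD, hβ₁, hβ₂⟩ :=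
    exists_isFreeAmalgam (α₁.comp j₁) (α₂.comp j₂) (hlang₁.trans hlang₂.symm)
  have heq : ∀ x ∈ C₁.carrier ∩ C₂.carrier, β₁ (f₁ x) = β₂ (f₂ x) := by
    intro x hx
    obtain ⟨a, rfl⟩ := hg hx
    rw [← hα₁ ⟨a, hx⟩, ← hα₂ ⟨a, hx⟩]
    exact congrArg (fun e : Emb K.str D => e ⟨a, hx⟩) hD.comm
  exact ⟨Z, D, _, .amalgam hD₁ hD₂ α₁ α₂ j₁ j₂ β₁ β₂ hD,
    h.factorsOnBlocks_piecewise (hf₁.comp β₁ hβ₁) (hf₂.comp β₂ hβ₂) heq⟩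

end CliqueSeparation

theorem Untwisted.hasTreeMap [Finite U] (hS : S.Covered) (hS' : S.Conformal) {C : Substr B}
    (hC : S.Untwisted C.carrier) : S.HasTreeMap C.carrier := by
  induction hn : C.carrier.ncard using Nat.strong_induction_on generalizing C with
  | _ n ih =>
    subst hn
    by_cases hclique : ∀ x ∈ C.carrier, ∀ y ∈ C.carrier, S.Adj x y
    · obtain ⟨g, hg⟩ := hS' _ hclique
      exact hasTreeMap_of_subset_block hS hg
    · push Not at hclique
      obtain ⟨x, hx, y, hy, hxy⟩ := hclique
      obtain ⟨C₁, C₂, hsep, h₁, h₂⟩ := exists_cliqueSeparation hS hC hx hy hxy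
      exact hsep.hasTreeMap hS' (ih _ (Set.ncard_lt_ncard h₁) (hC.mono h₁.subset) rfl)
        (ih _ (Set.ncard_lt_ncard h₂) (hC.mono h₂.subset) rfl)

end Atlas

/-! ### Unwinding small substructures -/

namespace Atlas

section Projections

variable {U' : Type*} {B' : GStr L U'} {S : Atlas A B} {T : Atlas A B'} {p : U' → U}

/-- The map `p` sends every copy of `A` to a copy of `A`. -/
def ProjectsTo (T : Atlas A B') (S : Atlas A B) (p : U' → U) : Prop :=
  ∀ g, ∃ h, (T.chart g).lang = (S.chart h).lang ∧ ∀ a, p (T.chart g a) = S.chart h a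

theorem factorsOnBlocks_id (S : Atlas A B) : S.FactorsOnBlocks Set.univ B id :=
  fun g K _ => ⟨K.incl, S.chart g, mul_one _, fun _ => rfl⟩

namespace ProjectsTo

theorem factorsOnBlocks_comp (hp : T.ProjectsTo S p) {C : Set U} {C' : Set U'} {Z : Type*}
    {D : GStr L Z} {f : U → Z} (hf : S.FactorsOnBlocks C D f) (h : Set.MapsTo p C' C) :
    T.FactorsOnBlocks C' D (f ∘ p) := by
  intro g K hK
  obtain ⟨k, hlang, hk⟩ := hp g
  obtain ⟨j, α, hα, hα'⟩ := hf k K (by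
    rintro _ ⟨a, ha, rfl⟩
    exact hk a ▸ h (hK ⟨a, ha, rfl⟩))
  exact ⟨j, α, hα.trans hlang.symm, fun a => (hα' a).trans (congrArg f (hk a).symm)⟩

theorem adj (hp : T.ProjectsTo S p) {x y : U'} (h : T.Adj x y) : S.Adj (p x) (p y) := by
  obtain ⟨g, ⟨a, rfl⟩, ⟨b, rfl⟩⟩ := h
  obtain ⟨k, -, hk⟩ := hp g
  exact ⟨k, ⟨a, (hk a).symm⟩, ⟨b, (hk b).symm⟩⟩

/-- The image of a substructure. -/
def image (hp : T.ProjectsTo S p) (hT : T.Covered) (C : Substr B') : Substr B where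
  carrier := p '' C.carrier
  closed := by
    rintro F _ ⟨x, hx, rfl⟩ y hy
    obtain ⟨g, a, rfl⟩ := hT.vertex x
    obtain ⟨k, hlang, hk⟩ := hp g
    obtain ⟨F, rfl⟩ := (T.chart g).lang.1.2.surjective F
    change y ∈ B.fn (PermLang.onFn (T.chart g).lang F) (p (T.chart g a)) at hy
    rw [hk, hlang, ← (S.chart k).image_fn] at hy
    obtain ⟨b, hb, rfl⟩ := hy
    exact ⟨T.chart g b, C.closed _ _ hx ((T.chart g).map_fn F a ⟨b, hb, rfl⟩), hk b⟩

end ProjectsTo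

/-- The pairs of vertices of `C` that lie in no common copy of `A`. -/
def nonadj (S : Atlas A B) (C : Set U) : Set (U × U) :=
  {q ∈ C ×ˢ C | ¬S.Adj q.1 q.2}

theorem ProjectsTo.ncard_nonadj_image_lt [Finite U'] (hp : T.ProjectsTo S p) {C : Set U'}
    {x y : U'} (hx : x ∈ C) (hy : y ∈ C) (hS : S.Adj (p x) (p y)) (hT : ¬T.Adj x y) :
    (S.nonadj (p '' C)).ncard < (T.nonadj C).ncard := by
  have hsub : S.nonadj (p '' C) ⊆ Prod.map p p '' {q ∈ T.nonadj C | ¬S.Adj (p q.1) (p q.2)} := by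
    rintro ⟨_, _⟩ ⟨⟨⟨x, hx, rfl⟩, ⟨y, hy, rfl⟩⟩, h⟩
    exact ⟨(x, y), ⟨⟨⟨hx, hy⟩, fun h' => h (hp.adj h')⟩, h⟩, rfl⟩
  calc (S.nonadj (p '' C)).ncard
      ≤ {q ∈ T.nonadj C | ¬S.Adj (p q.1) (p q.2)}.ncard :=
        (Set.ncard_le_ncard hsub (Set.toFinite _)).trans (Set.ncard_image_le (Set.toFinite _))
    _ < (T.nonadj C).ncard :=
        Set.ncard_lt_ncard ⟨Set.sep_subset _ _, fun h => (h (a := (x, y)) ⟨⟨hx, hy⟩, hT⟩).2 hS⟩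
          (Set.toFinite _)

end Projections

end Atlas

theorem LocalSystem.cover_projectsTo {S : Atlas A B} {I : Type w₁} {X : Type}
    [MulAction S.G I] (Λ : LocalSystem S I X) : Λ.cover.ProjectsTo S (fun v => v.1.1) :=
  fun g => ⟨g.1.1, rfl, fun a => congrArg Prod.fst (coe_cover_chart g a)⟩

namespace Atlas

variable {V : Type w} {A : GStr L V}

theorem hasTreeMap_twistSystem_cover [Finite U] {S : Atlas A B} (hS : S.Covered)
    (hS' : S.Conformal) {C : Substr S.twistSystem.coverStr}
    (h : ∀ C' : Substr B,
      (S.nonadj C'.carrier).ncard < (S.twistSystem.cover.nonadj C.carrier).ncard →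
        S.HasTreeMap C'.carrier) :
    S.twistSystem.cover.HasTreeMap C.carrier := by
  have := S.twistSystem.finite_coverVertex
  have hp := S.twistSystem.cover_projectsTo
  have himage : S.HasTreeMap (hp.image S.twistSystem.cover_covered C).carrier := by
    by_cases hC : ∀ v ∈ C.carrier, ∀ w ∈ C.carrier,
        S.Adj v.1.1 w.1.1 → S.twistSystem.cover.Adj v w
    · exact Untwisted.hasTreeMap hS hS' (untwisted_image hC)
    · push Not at hC
      obtain ⟨v, hv, w, hw, hvw, hvw'⟩ := hC
      exact h _ (hp.ncard_nonadj_image_lt hv hw hvw hvw')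
  obtain ⟨Z, D, f, hD, hf⟩ := himage
  exact ⟨Z, D, _, hD, hp.factorsOnBlocks_comp hf (Set.mapsTo_image _ _)⟩

theorem exists_unwinding [Finite U] (S : Atlas A B) (k : ℕ) :
    ∃ (U' : Type w₁) (_ : Finite U') (B' : GStr L U') (T : Atlas A B'),
      T.Covered ∧ T.Conformal ∧ (S.Coherent → T.Coherent) ∧
      (∃ p, T.FactorsOnBlocks Set.univ B p) ∧
      ∀ C : Substr B', (T.nonadj C.carrier).ncard < k → T.HasTreeMap C.carrier := by
  induction k with
  | zero =>
    exact ⟨_, S.cliqueSystem.finite_coverVertex, _, S.cliqueSystem.cover,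
      S.cliqueSystem.cover_covered, S.cliqueSystem_cover_conformal, S.cliqueSystem.cover_coherent,
      ⟨_, S.cliqueSystem.cover_projectsTo.factorsOnBlocks_comp S.factorsOnBlocks_id
        (Set.mapsTo_univ _ _)⟩, fun _ h => absurd h (Nat.not_lt_zero _)⟩
  | succ k ih =>
    obtain ⟨U', _, B', T, hT, hT', hcoh, ⟨p, hp⟩, h⟩ := ih
    exact ⟨_, T.twistSystem.finite_coverVertex, _, T.twistSystem.cover,
      T.twistSystem.cover_covered, hT'.twistSystem_cover,
      fun hS => T.twistSystem.cover_coherent (hcoh hS),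
      ⟨_, T.twistSystem.cover_projectsTo.factorsOnBlocks_comp hp (Set.mapsTo_univ _ _)⟩,
      fun C hC => hasTreeMap_twistSystem_cover hT hT' fun C' hC' =>
        h C' (hC'.trans_le (Nat.le_of_lt_succ hC))⟩

theorem exists_small_unwinding [Finite U] (S : Atlas A B) (n : ℕ) :
    ∃ (U' : Type w₁) (_ : Finite U') (B' : GStr L U') (T : Atlas A B'),
      T.Covered ∧ T.Conformal ∧ (S.Coherent → T.Coherent) ∧
      (∃ p, T.FactorsOnBlocks Set.univ B p) ∧
      ∀ C : Substr B', C.carrier.ncard ≤ n → T.HasTreeMap C.carrier := by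
  obtain ⟨U', hU', B', T, hT, hT', hcoh, hp, h⟩ := S.exists_unwinding (n * n + 1)
  refine ⟨U', hU', B', T, hT, hT', hcoh, hp, fun C hC => h C (Nat.lt_succ_of_le ?_)⟩
  calc (T.nonadj C.carrier).ncard
      ≤ (C.carrier ×ˢ C.carrier).ncard := Set.ncard_le_ncard (Set.sep_subset _ _) (Set.toFinite _)
    _ = C.carrier.ncard * C.carrier.ncard := Set.ncard_prod
    _ ≤ n * n := Nat.mul_le_mul hC hC

end Atlas

/-! ### EPPA-witnesses -/

section Transport

variable {V W : Type*} {A : GStr L V} {B : GStr L W}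

/-- An embedding, as an isomorphism to its image. -/
noncomputable def Emb.toRange (e : Emb A B) : Emb A e.range.str :=
  e.range.incl.lift e fun a => ⟨⟨e a, a, rfl⟩, rfl⟩

/-- The inverse of an embedding, as an isomorphism from its image. -/
noncomputable def Emb.ofRange (e : Emb A B) : Emb e.range.str A :=
  e.lift e.range.incl fun x => x.2

@[simp] theorem Emb.toRange_lang (e : Emb A B) : e.toRange.lang = e.lang :=
  (e.range.incl.lift_lang e _).trans (by simp)

@[simp] theorem Emb.ofRange_lang (e : Emb A B) : e.ofRange.lang = e.lang⁻¹ := mul_one _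

@[simp] theorem Emb.coe_toRange (e : Emb A B) (a : V) : (e.toRange a : W) = e a :=
  e.range.incl.apply_lift e _ a

@[simp] theorem Emb.apply_ofRange (e : Emb A B) (x : e.range.carrier) : e (e.ofRange x) = x :=
  e.apply_lift e.range.incl _ x

theorem Emb.ofRange_apply (e : Emb A B) {a : V} (h : e a ∈ e.range.carrier) :
    e.ofRange ⟨e a, h⟩ = a :=
  e.injective (e.apply_ofRange _)

namespace PartialAut

/-- A partial automorphism, as an embedding of its domain in its range. -/
def emb (f : PartialAut A) : Emb f.dom.str f.ran.str := ⟨f.map, f.isIso.toIsEmbedding⟩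

/-- The conjugate of a partial automorphism by an embedding. -/
noncomputable def push (i : Emb A B) (f : PartialAut A) : PartialAut B where
  dom := (i.comp f.dom.incl).range
  ran := (i.comp f.ran.incl).range
  map := ((i.comp f.ran.incl).toRange.comp (f.emb.comp (i.comp f.dom.incl).ofRange)).toHom
  isIso :=
    { toIsEmbedding := Emb.isEmbedding _
      surjective := by
        rintro ⟨_, b, rfl⟩
        obtain ⟨a, rfl⟩ := f.isIso.surjective b
        refine ⟨⟨_, a, rfl⟩, Subtype.ext ((Emb.coe_toRange _ _).trans ?_)⟩
        exact congrArg (fun c => i (f.map c)) (Emb.ofRange_apply _ _) }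

theorem push_lang (i : Emb A B) (f : PartialAut A) :
    (f.push i).map.lang = i.lang * f.map.lang * i.lang⁻¹ := by
  change ((i.comp f.ran.incl).toRange.comp (f.emb.comp (i.comp f.dom.incl).ofRange)).lang = _
  simp [emb, mul_assoc]

theorem push_apply (i : Emb A B) (f : PartialAut A) (a : f.dom.carrier)
    (h : i a ∈ (f.push i).dom.carrier) : ((f.push i).map ⟨i a, h⟩ : W) = i (f.map a) :=
  (Emb.coe_toRange _ _).trans
    (congrArg (fun c => i (f.map c)) ((i.comp f.dom.incl).ofRange_apply h))

end PartialAut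

theorem CoherentTriple.push (i : Emb A B) {f g h : PartialAut A} (H : CoherentTriple f g h) :
    CoherentTriple (f.push i) (g.push i) (h.push i) where
  dom_eq := congrArg (fun S => (i.comp (Substr.incl S)).range) H.dom_eq
  mid_eq := congrArg (fun S => (i.comp (Substr.incl S)).range) H.mid_eq
  ran_eq := congrArg (fun S => (i.comp (Substr.incl S)).range) H.ran_eq
  lang_eq := by
    rw [PartialAut.push_lang, PartialAut.push_lang, PartialAut.push_lang, H.lang_eq]
    group
  map_eq := by
    rintro _ ⟨⟨a, ha⟩, rfl⟩ hg hh
    have ha' : a ∈ h.dom.carrier := H.dom_eq ▸ ha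
    have hb : (f.map ⟨a, ha⟩ : V) ∈ g.dom.carrier := H.mid_eq ▸ (f.map ⟨a, ha⟩).2
    have hgb : i (f.map ⟨a, ha⟩) ∈ (g.push i).dom.carrier := ⟨⟨_, hb⟩, rfl⟩
    calc ((h.push i).map ⟨i a, hh⟩ : W)
        = i (h.map ⟨a, ha'⟩) := h.push_apply i ⟨a, ha'⟩ hh
      _ = i (g.map ⟨f.map ⟨a, ha⟩, hb⟩) := congrArg i (H.map_eq a ha hb ha')
      _ = (g.push i).map ⟨i (f.map ⟨a, ha⟩), hgb⟩ := (g.push_apply i ⟨_, hb⟩ hgb).symm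
      _ = (g.push i).map ⟨(f.push i).map ⟨i a, ⟨a, ha⟩, rfl⟩, hg⟩ :=
        congrArg (fun x => ((g.push i).map x : W))
          (Subtype.ext (f.push_apply i ⟨a, ha⟩ ⟨⟨a, ha⟩, rfl⟩).symm)

theorem IsEPPAWitness.exists_extension (hB : IsEPPAWitness A B) :
    ∃ (ψ : Emb A B) (φ : PartialAut ψ.range.str → Hom B B),
      (∀ f, (φ f).IsIso ∧ Extends (φ f) f) ∧ (IsCoherentEPPAWitness A B →
        ∀ f g h, CoherentTriple f g h → φ h = (φ g).comp (φ f)) := by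
  by_cases hc : IsCoherentEPPAWitness A B
  · obtain ⟨ψ, φ, hφ, hcoh⟩ := hc
    exact ⟨ψ, φ, hφ, fun _ => hcoh⟩
  · obtain ⟨ψ, hψ⟩ := hB
    choose φ hφ using hψ
    exact ⟨ψ, φ, hφ, fun h => (hc h).elim⟩

/-- The group of automorphisms, as pairs of a permutation of the language and a permutation of the
vertices. -/
def autGroup (B : GStr L W) : Subgroup (L.Γ × Perm W) where
  carrier := {g | ∃ e : Emb B B, e.lang = g.1 ∧ ∀ x, e x = g.2 x}
  one_mem' := ⟨Emb.id B, rfl, fun _ => rfl⟩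
  mul_mem' := by
    rintro g h ⟨e, he, he'⟩ ⟨k, hk, hk'⟩
    exact ⟨e.comp k, congrArg₂ (· * ·) he hk, fun x => by simp [he', hk']⟩
  inv_mem' := by
    rintro g ⟨e, he, he'⟩
    have hsurj (x : W) : Emb.id B x ∈ Set.range e := ⟨g.2.symm x, by simp [he', Emb.id, Emb.ofEq]⟩
    refine ⟨e.lift (Emb.id B) hsurj, by simp [he, Emb.id, Emb.ofEq], fun x => ?_⟩
    exact e.eq_lift _ hsurj (by simp [he', Emb.id, Emb.ofEq])

instance : MulAction B.autGroup W :=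
  MulAction.compHom W ((MonoidHom.snd _ _).comp B.autGroup.subtype)

/-- An automorphism, as an element of the automorphism group. -/
noncomputable def Hom.IsIso.toAut {f : Hom B B} (hf : f.IsIso) : B.autGroup :=
  ⟨(f.lang, .ofBijective f ⟨hf.injective, hf.surjective⟩), ⟨f, hf.toIsEmbedding⟩, rfl, fun _ => rfl⟩

end Transport

namespace Atlas

section Witness

variable {ψ : Emb A B} {φ : PartialAut ψ.range.str → Hom B B}

/-- The atlas of an EPPA-witness, with the full automorphism group. -/
noncomputable def ofWitness (hφ : ∀ f, (φ f).IsIso ∧ Extends (φ f) f) : Atlas A B where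
  G := B.autGroup
  lang := (MonoidHom.fst _ _).comp B.autGroup.subtype
  smul_mem_rel := by
    rintro ⟨g, e, he, he'⟩ k R x hx
    have h := e.map_rel R x hx
    simp only [he, he'] at h
    exact h
  smul_mem_fn := by
    rintro ⟨g, e, he, he'⟩ F x y hy
    have h := e.map_fn F x ⟨y, hy, rfl⟩
    simp only [he, he'] at h
    exact h
  ψ := ψ
  φ f := (hφ (f.push ψ.toRange)).1.toAut
  lang_φ f := (hφ _).2.1.trans (by rw [PartialAut.push_lang, Emb.toRange_lang])
  φ_smul f a := by
    have h := ((hφ (f.push ψ.toRange)).2.2 ⟨ψ.toRange a, a, rfl⟩).trans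
      (congrArg Subtype.val (f.push_apply ψ.toRange a ⟨a, rfl⟩))
    rw [Emb.coe_toRange, Emb.coe_toRange] at h
    exact h

theorem coherent_ofWitness (hφ : ∀ f, (φ f).IsIso ∧ Extends (φ f) f)
    (hcoh : ∀ f g h, CoherentTriple f g h → φ h = (φ g).comp (φ f)) : (ofWitness hφ).Coherent := by
  intro f g h H
  have hcomp := hcoh _ _ _ (H.push ψ.toRange)
  exact Subtype.ext (Prod.ext (congrArg Hom.lang hcomp)
    (Equiv.ext fun x => congrArg (fun e : Hom B B => e x) hcomp))

end Witness

/-- The extension of a partial automorphism of `ψ(A)`. -/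
noncomputable def extension (S : Atlas A B) (f : PartialAut S.ψ.range.str) : Emb B B :=
  S.autEmb (S.φ (f.push S.ψ.ofRange))

variable (S : Atlas A B)

theorem extends_extension (f : PartialAut S.ψ.range.str) : Extends (S.extension f).toHom f := by
  refine ⟨(S.lang_φ _).trans ?_, fun x => ?_⟩
  · rw [PartialAut.push_lang, Emb.ofRange_lang]
    group
  · have h := (S.φ_smul (f.push S.ψ.ofRange) ⟨S.ψ.ofRange x, x, rfl⟩).trans
      (congrArg S.ψ (f.push_apply S.ψ.ofRange x ⟨x, rfl⟩))
    rw [Emb.apply_ofRange, Emb.apply_ofRange] at h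
    exact h

theorem isEPPAVia : IsEPPAVia S.ψ := fun f => ⟨_, S.autEmb_isIso _, S.extends_extension f⟩

variable {S}

theorem Coherent.isCoherentVia (hS : S.Coherent) : IsCoherentVia S.ψ := by
  refine ⟨fun f => (S.extension f).toHom, fun f => ⟨S.autEmb_isIso _, S.extends_extension f⟩,
    fun f g h H => ?_⟩
  have hmul := hS _ _ _ (H.push S.ψ.ofRange)
  exact Hom.ext' ((congrArg S.lang hmul).trans (map_mul _ _ _))
    fun x => (congrArg (· • x) hmul).trans (mul_smul _ _ x)

end Atlas

end GStr

open GStr in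
theorem theorem1p2_general {L : PermLang.{u, v}} {V : Type w} {W : Type w₁} [Finite W]
    (A : GStr L V) (B₀ : GStr L W) (hB₀ : IsEPPAWitness A B₀) (n : ℕ) :
    ∃ (U : Type w₁) (_ : Finite U) (B : GStr L U) (ψ : Emb A B),
      IsEPPAVia ψ ∧ IsFaithfulVia ψ ∧
      (∃ f : Hom B B₀, f.IsHomEmbedding) ∧
      (∀ C : Substr B, C.carrier.ncard ≤ n →
        ∃ (Z : Type w) (D : GStr L Z), IsTreeAmalgam A D ∧
          ∃ f : Hom C.str D, f.IsHomEmbedding) ∧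
      (IsCoherentEPPAWitness A B₀ → IsCoherentVia ψ) := by
  obtain ⟨ψ₀, φ₀, hφ₀, hcoh⟩ := hB₀.exists_extension
  obtain ⟨U, hU, B, T, hT, hT', hTcoh, ⟨p, hp⟩, htree⟩ :=
    (Atlas.ofWitness hφ₀).exists_small_unwinding n
  refine ⟨U, hU, B, T.ψ, T.isEPPAVia, hT.isFaithfulVia hT',
    ⟨_, hp.hom_isHomEmbedding hT hT' (Emb.id B) fun _ => Set.mem_univ _⟩, fun C hC => ?_,
    fun hB => (hTcoh (Atlas.coherent_ofWitness hφ₀ (hcoh hB))).isCoherentVia⟩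
  obtain ⟨Z, D, f, hD, hf⟩ := htree C hC
  exact ⟨Z, D, hD, _, hf.hom_isHomEmbedding hT hT' C.incl Subtype.prop⟩

theorem theorem1p2 {L : PermLang.{u, v}} {V W : Type w} [Finite V] [Finite W]
    (A : GStr L V) (hA : A.Irreducible)
    (B₀ : GStr L W) (hB₀ : GStr.IsEPPAWitness A B₀) (n : ℕ) (hn : 1 ≤ n) :
    ∃ (U : Type w) (_ : Finite U) (B : GStr L U) (ψ : GStr.Emb A B),
      GStr.IsEPPAVia ψ ∧ GStr.IsFaithfulVia ψ ∧
      (∃ f : GStr.Hom B B₀, f.IsHomEmbedding) ∧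
      (∀ C : GStr.Substr B, C.carrier.ncard ≤ n →
        ∃ (Z : Type w) (D : GStr L Z), GStr.IsTreeAmalgam A D ∧
          ∃ f : GStr.Hom C.str D, f.IsHomEmbedding) ∧
      (GStr.IsCoherentEPPAWitness A B₀ → GStr.IsCoherentVia ψ) :=
  theorem1p2_general A B₀ hB₀ n
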